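/- Let $F\subset \mathrm{Sym}^2(\mathbb R^n)$ be a closed set of real symmetric $n\times n$ matrices such that - (positivity) $A+P\in F$ for all $A\in F$ and all positive semidefinite $P$ ("$F$ is a subequation"); - (cone property) $tF\subset F$ for all real $t\ge 0$; - $F$ is convex; - (ST-invariance) there is a subgroup $G\subset \mathrm O(n)$ acting transitively on the unit sphere $S=S^{n-1}$ with $gAg^{T}\in F$ for all $g\in G$, $A\in F$. For an open set $X\subset\mathbb R^n$, a function $u:X\to[-\infty,\infty)$ is *$F$-subharmonic* on $X$ if it is upper semicontinuous and, whenever $x\in X$ and $\varphi$ is a $C^2$ function near $x$ with $u\le\varphi$ near $x$ and $u(x)=\varphi(x)$, one has $D^2_x\varphi\in F$. It is *$F$-harmonic* on $X$ if $u$ is $F$-subharmonic and $-u$ is $\widetilde F$-subharmonic on $X$, where $\widetilde F=-(\mathrm{Sym}^2(\mathbb R^n)\setminus \mathrm{Int}\,F)$ (so $u$ is then real-valued and continuous). An $F$-subharmonic function $u$ on $X$ is *$F$-maximal* on $X$ if for each $F$-subharmonic function $v$ on $X$ and each compact set $K\subset X$, $$v\le u \ \text{ on } X\setminus K\quad\Longrightarrow\quad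 v\le u\ \text{ on } X .$$ **Theorem (Maximality Criterion).** Let $0\le a$ and $b\le\infty$, let $A=A(a,b)=\{x\in\mathbb R^n: a<|x|<b\}$, and let $U$ be an $F$-subharmonic function on $A$, with spherical averages $$S(U,t)=\frac1{|S|}\int_S U(t\sigma)\,d\sigma\in[-\infty,\infty),\qquad a<t<b .$$ If $t\mapsto S(U,t)$ is increasing (i.e. non-decreasing) on $(a,b)$ and $x\mapsto S(U,|x|)$ is $F$-harmonic on $A$, then $U$ is $F$-maximal on $A$. -/

import Mathlib

open MeasureTheory Topology

noncomputable section

namespace STCone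

/-- Euclidean space `ℝⁿ`. -/
abbrev Rn (n : ℕ) : Type := EuclideanSpace ℝ (Fin n)

/-- The space `Sym²(ℝⁿ)` of real symmetric `n × n` matrices (as the self-adjoint elements of the
matrix ring), with its topology and its real vector space structure. -/
abbrev SymMat (n : ℕ) : Type := selfAdjoint (Matrix (Fin n) (Fin n) ℝ)

/-- The action `A ↦ g A gᵀ` of `O(n)` on symmetric matrices. -/
def conj {n : ℕ} (g : Matrix.orthogonalGroup (Fin n) ℝ) (A : SymMat n) : SymMat n :=
  ⟨(g : Matrix (Fin n) (Fin n) ℝ) * (A : Matrix (Fin n) (Fin n) ℝ) *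
    star (g : Matrix (Fin n) (Fin n) ℝ), A.2.conjugate' _⟩

/-- A (constant coefficient, pure second order) subequation: a closed set `F` of symmetric
matrices such that `F + {P ≥ 0} ⊆ F`. -/
structure IsSubequation {n : ℕ} (F : Set (SymMat n)) : Prop where
  isClosed : IsClosed F
  positivity : ∀ A ∈ F, ∀ P : SymMat n, (P : Matrix (Fin n) (Fin n) ℝ).PosSemidef → A + P ∈ F

/-- The cone property: `t F ⊆ F` for all `t ≥ 0`. -/
def IsCone {n : ℕ} (F : Set (SymMat n)) : Prop :=
  ∀ t : ℝ, 0 ≤ t → ∀ A ∈ F, t • A ∈ F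

/-- ST-invariance: `F` is invariant under some subgroup of `O(n)` which acts transitively on the
unit sphere. -/
def IsSTInvariant {n : ℕ} (F : Set (SymMat n)) : Prop :=
  ∃ G : Subgroup (Matrix.orthogonalGroup (Fin n) ℝ),
    (∀ x y : Rn n, ‖x‖ = 1 → ‖y‖ = 1 →
      ∃ g ∈ G, Matrix.toEuclideanLin (g : Matrix (Fin n) (Fin n) ℝ) x = y) ∧
    ∀ g ∈ G, ∀ A ∈ F, conj g A ∈ F

/-- The Hessian matrix `D²φ(x)`. -/
def hessian {n : ℕ} (φ : Rn n → ℝ) (x : Rn n) : Matrix (Fin n) (Fin n) ℝ :=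
  Matrix.of fun i j =>
    fderiv ℝ (fderiv ℝ φ) x (EuclideanSpace.single i 1) (EuclideanSpace.single j 1)

/-- `F`-subharmonic functions on an open set `X`, in the viscosity sense: `u` is upper
semicontinuous on `X` with values in `[-∞, ∞)`, and `D²φ(x) ∈ F` whenever `φ` is `C²` near a point
`x ∈ X` and touches `u` from above at `x`. (Values of `u` outside `X` are irrelevant.) -/
structure IsSubharmonic {n : ℕ} (F : Set (SymMat n)) (X : Set (Rn n)) (u : Rn n → EReal) :
    Prop where
  usc : UpperSemicontinuousOn u X
  lt_top : ∀ x ∈ X, u x < ⊤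
  viscosity : ∀ x ∈ X, ∀ φ : Rn n → ℝ, ContDiffAt ℝ 2 φ x →
    (∀ᶠ y in 𝓝 x, u y ≤ (φ y : EReal)) → u x = (φ x : EReal) →
    ∃ A ∈ F, (A : Matrix (Fin n) (Fin n) ℝ) = hessian φ x

/-- The dual subequation `F̃ = -(∼ Int F)`, the interior being taken in `Sym²(ℝⁿ)`. -/
def dual {n : ℕ} (F : Set (SymMat n)) : Set (SymMat n) :=
  {A | -A ∉ interior F}

/-- `F`-harmonic functions: `u` is `F`-subharmonic and `-u` is `F̃`-subharmonic. In particular `u`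
is real-valued and continuous on `X`. -/
def IsHarmonic {n : ℕ} (F : Set (SymMat n)) (X : Set (Rn n)) (u : Rn n → EReal) : Prop :=
  IsSubharmonic F X u ∧ IsSubharmonic (dual F) X (fun x => -u x)

/-- `F`-maximal functions on an open set `X`. -/
def IsMaximal {n : ℕ} (F : Set (SymMat n)) (X : Set (Rn n)) (u : Rn n → EReal) : Prop :=
  IsSubharmonic F X u ∧
    ∀ v : Rn n → EReal, IsSubharmonic F X v →
      ∀ K : Set (Rn n), K ⊆ X → IsCompact K →
        (∀ x ∈ X \ K, v x ≤ u x) → ∀ x ∈ X, v x ≤ u x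

/-- The open annulus `A(a, b) = {x : a < |x| < b}`; the outer radius `b` may be `∞`. -/
def annulus (n : ℕ) (a : ℝ) (b : EReal) : Set (Rn n) :=
  {x | a < ‖x‖ ∧ (‖x‖ : EReal) < b}

/-- Normalized surface measure on the unit sphere. -/
def sphereMeasure (n : ℕ) : Measure (Metric.sphere (0 : Rn n) 1) :=
  ((volume : Measure (Rn n)).toSphere Set.univ)⁻¹ • (volume : Measure (Rn n)).toSphere

/-- The spherical average `S(u, t) = ⨍ u(tσ) dσ ∈ [-∞, ∞)`, as the integral of the positive part
minus the integral of the negative part. If `u` is upper semicontinuous with values `< ∞` on the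
sphere of radius `t`, the positive part is bounded, so that the first integral is finite. -/
def sphericalAverage {n : ℕ} (u : Rn n → EReal) (t : ℝ) : EReal :=
  ((∫⁻ σ : Metric.sphere (0 : Rn n) 1, (u (t • (σ : Rn n))).toENNReal ∂(sphereMeasure n) :
      ENNReal) : EReal) -
    ((∫⁻ σ : Metric.sphere (0 : Rn n) 1, (-u (t • (σ : Rn n))).toENNReal ∂(sphereMeasure n) :
      ENNReal) : EReal)

end STCone

end

/-!
A convex cone subequation `F` other than `∅` and `Sym²(ℝⁿ)` is the intersection of the elliptic
half spaces `{ℓ ≥ 0}` containing it. For each such `ℓ` the Dirichlet problem on a ball with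
polynomial data has a polynomial solution, so that the maximum principle yields a harmonic measure
`μ` on the sphere, and `F`-subharmonic functions satisfy the sub-mean value inequality for `μ`.
This inequality survives averaging over the rotations, because ST-invariance lets the group act on
`F`-subharmonic functions; hence the spherical average of an `F`-subharmonic function is again
`F`-subharmonic.

Suppose now `v ≤ U` outside a compact set and put `w = U ⊔ v`. The radial functions `S(U, ·)` and
`S(w, ·)` agree near both ends of the annulus. An increasing radial `F`-harmonic function is
maximal, by comparison with the functions `α K_p + c`, where `K_p` is the Riesz kernel and `p` the
Riesz characteristic of `F`. So `S(w, ·) ≤ S(U, ·)`, which forces `w = U` almost everywhere, and the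
sub-mean value inequality for `w` together with the upper semicontinuity of `U` gives `w ≤ U`
everywhere.
-/

noncomputable section

namespace STCone

variable {n : ℕ}

/-! ### Hessians -/

section Hessian

variable {φ ψ : Rn n → ℝ} {x : Rn n}

theorem eventually_differentiableAt (h : ContDiffAt ℝ 2 φ x) :
    ∀ᶠ y in 𝓝 x, DifferentiableAt ℝ φ y :=
  (h.eventually (by simp)).mono fun _ hy => hy.differentiableAt (by simp)

theorem differentiableAt_fderiv (h : ContDiffAt ℝ 2 φ x) :
    DifferentiableAt ℝ (fderiv ℝ φ) x :=
  (h.fderiv_right (m := 1) (by norm_num)).differentiableAt (by simp)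

theorem hessian_isSelfAdjoint (h : ContDiffAt ℝ 2 φ x) : IsSelfAdjoint (hessian φ x) := by
  have hsymm := h.isSymmSndFDerivAt (by simp)
  ext i j
  simpa [hessian, Matrix.star_eq_conjTranspose] using hsymm.eq _ _

theorem fderiv_fderiv_apply (φ : Rn n → ℝ) (x u v : Rn n) :
    fderiv ℝ (fderiv ℝ φ) x u v = ∑ i, ∑ j, u i * v j * hessian φ x i j := by
  have hsum (w : Rn n) : w = ∑ i, w i • EuclideanSpace.single i (1 : ℝ) := by
    simpa using ((EuclideanSpace.basisFun (Fin n) ℝ).sum_repr w).symm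
  conv_lhs => rw [hsum u, hsum v]
  simp only [map_sum, map_smul, sum_apply, smul_apply, smul_eq_mul, hessian, Matrix.of_apply,
    Finset.mul_sum]
  rw [Finset.sum_comm]
  exact Finset.sum_congr rfl fun i _ => Finset.sum_congr rfl fun j _ => by ring

theorem hessian_const (c : ℝ) (x : Rn n) : hessian (fun _ => c) x = 0 := by
  have : fderiv ℝ (fun _ : Rn n => c) = fun _ => 0 := by ext; simp
  ext i j
  simp [hessian, this]

theorem hessian_add (hφ : ContDiffAt ℝ 2 φ x) (hψ : ContDiffAt ℝ 2 ψ x) :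
    hessian (fun y => φ y + ψ y) x = hessian φ x + hessian ψ x := by
  have : fderiv ℝ (fun y => φ y + ψ y) =ᶠ[𝓝 x] fun y => fderiv ℝ φ y + fderiv ℝ ψ y := by
    filter_upwards [eventually_differentiableAt hφ, eventually_differentiableAt hψ] with y hφy hψy
    exact fderiv_fun_add hφy hψy
  ext i j
  simp [hessian, this.fderiv_eq, fderiv_fun_add (differentiableAt_fderiv hφ)
    (differentiableAt_fderiv hψ)]

theorem hessian_const_mul (hφ : ContDiffAt ℝ 2 φ x) (c : ℝ) :
    hessian (fun y => c * φ y) x = c • hessian φ x := by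
  have : fderiv ℝ (fun y => c * φ y) =ᶠ[𝓝 x] fun y => c • fderiv ℝ φ y := by
    filter_upwards [eventually_differentiableAt hφ] with y hφy
    exact fderiv_const_mul hφy c
  ext i j
  simp [hessian, this.fderiv_eq, fderiv_fun_const_smul (differentiableAt_fderiv hφ)]

theorem hessian_neg (hφ : ContDiffAt ℝ 2 φ x) :
    hessian (fun y => -φ y) x = -hessian φ x := by
  simpa using hessian_const_mul hφ (-1)

theorem hessian_sub (hφ : ContDiffAt ℝ 2 φ x) (hψ : ContDiffAt ℝ 2 ψ x) :
    hessian (fun y => φ y - ψ y) x = hessian φ x - hessian ψ x := by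
  simp only [sub_eq_add_neg]
  rw [hessian_add hφ hψ.neg, hessian_neg hψ]

theorem hessian_comp_affine {b : Rn n} (M : Matrix (Fin n) (Fin n) ℝ)
    (hφ : ContDiffAt ℝ 2 φ (b + Matrix.toEuclideanLin M x)) :
    hessian (fun y => φ (b + Matrix.toEuclideanLin M y)) x =
      M.transpose * hessian φ (b + Matrix.toEuclideanLin M x) * M := by
  set T : Rn n →L[ℝ] Rn n := LinearMap.toContinuousLinearMap (Matrix.toEuclideanLin M)
  have hT (y : Rn n) : HasFDerivAt (fun y => b + T y) T y := T.hasFDerivAt.const_add b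
  have hfst : fderiv ℝ (fun y => φ (b + T y)) =ᶠ[𝓝 x] fun y => (fderiv ℝ φ (b + T y)).comp T := by
    filter_upwards [(hT x).continuousAt.eventually (eventually_differentiableAt hφ)] with y hy
    exact (hy.hasFDerivAt.comp y (hT y)).fderiv
  have hsnd : HasFDerivAt (fun y => (fderiv ℝ φ (b + T y)).comp T) _ x :=
    ((differentiableAt_fderiv hφ).hasFDerivAt.comp x (hT x)).clm_comp (hasFDerivAt_const T x)
  have hcol (i k : Fin n) : (T (EuclideanSpace.single i 1)) k = M k i := by
    simp [T, Matrix.toLpLin_apply, Matrix.toEuclideanLin]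
  ext i j
  change fderiv ℝ (fderiv ℝ (fun y => φ (b + T y))) x _ _ = _
  rw [hfst.fderiv_eq, hsnd.fderiv]
  simp only [ContinuousLinearMap.comp_zero, zero_add, ContinuousLinearMap.comp_apply,
    ContinuousLinearMap.compL_apply, ContinuousLinearMap.flip_apply, fderiv_fderiv_apply, hcol,
    Matrix.mul_apply, Matrix.transpose_apply, Finset.sum_mul]
  rw [Finset.sum_comm]
  exact Finset.sum_congr rfl fun k _ => Finset.sum_congr rfl fun l _ => mul_right_comm _ _ _

theorem hessian_comp_norm_sq {k k' : ℝ → ℝ} {k'' : ℝ}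
    (hk : ∀ᶠ q in 𝓝 (‖x‖ ^ 2), HasDerivAt k (k' q) q) (hk' : HasDerivAt k' k'' (‖x‖ ^ 2)) :
    hessian (fun y => k (‖y‖ ^ 2)) x =
      (4 * k'') • Matrix.vecMulVec x x + (2 * k' (‖x‖ ^ 2)) • 1 := by
  let J : Rn n →L[ℝ] (Rn n →L[ℝ] ℝ) := (2 : ℝ) • innerSL ℝ
  have hJ (u v : Rn n) : J u v = 2 * inner ℝ u v :=
    congrArg (2 * ·) (innerSL_apply_apply ℝ u v)
  have hq (y : Rn n) : HasFDerivAt (fun y : Rn n => ‖y‖ ^ 2) (J y) y := by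
    rw [show J y = (2 : ℕ) • innerSL ℝ y from ofNat_smul_eq_nsmul ℝ 2 _]
    exact (hasStrictFDerivAt_norm_sq y).hasFDerivAt
  have hfst : fderiv ℝ (fun y : Rn n => k (‖y‖ ^ 2)) =ᶠ[𝓝 x] fun y => k' (‖y‖ ^ 2) • J y := by
    filter_upwards [(hq x).continuousAt.eventually hk] with y hy
    exact (hy.comp_hasFDerivAt y (hq y)).fderiv
  have hsnd : HasFDerivAt (fun y : Rn n => k' (‖y‖ ^ 2) • J y)
      (k' (‖x‖ ^ 2) • J + (k'' • J x).smulRight (J x)) x :=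
    (hk'.comp_hasFDerivAt x (hq x)).smul J.hasFDerivAt
  ext i j
  simp only [hessian, Matrix.of_apply]
  rw [hfst.fderiv_eq, hsnd.fderiv]
  change k' (‖x‖ ^ 2) * J (EuclideanSpace.single i (1 : ℝ)) (EuclideanSpace.single j (1 : ℝ)) +
    (k'' * J x (EuclideanSpace.single i (1 : ℝ))) * J x (EuclideanSpace.single j (1 : ℝ)) = _
  simp only [hJ, Matrix.add_apply, Matrix.smul_apply, Matrix.vecMulVec_apply, Matrix.one_apply,
    EuclideanSpace.inner_single_right, PiLp.single_apply, smul_eq_mul]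
  rcases eq_or_ne i j with rfl | hij
  · simp
    ring
  · simp [hij, hij.symm]
    ring

theorem contDiff_mul_norm_sub_sq (c : ℝ) (z : Rn n) :
    ContDiff ℝ 2 fun y : Rn n => c * ‖y - z‖ ^ 2 :=
  contDiff_const.mul ((contDiff_norm_sq ℝ).comp (contDiff_id.sub contDiff_const))

theorem hessian_mul_norm_sub_sq (c : ℝ) (z x : Rn n) :
    hessian (fun y => c * ‖y - z‖ ^ 2) x = (2 * c) • 1 := by
  have hcentered (w : Rn n) : hessian (fun y => c * ‖y‖ ^ 2) w = (2 * c) • 1 := by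
    simpa using hessian_comp_norm_sq (k := fun q => c * q) (k' := fun _ => c) (x := w)
      (.of_forall fun q => by simpa using (hasDerivAt_id q).const_mul c) (hasDerivAt_const _ _)
  have hshift := hessian_comp_affine (φ := fun y => c * ‖y‖ ^ 2) (b := -z) (x := x) 1
    (contDiff_const.mul (contDiff_norm_sq ℝ)).contDiffAt
  simpa [neg_add_eq_sub, hcentered] using hshift

end Hessian

theorem deriv_deriv_nonpos_of_isLocalMax {f : ℝ → ℝ} {t : ℝ} (h : IsLocalMax f t)
    (hc : ContinuousAt f t) : deriv (deriv f) t ≤ 0 := by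
  by_contra! hpos
  have hmin := isLocalMin_of_deriv_deriv_pos hpos h.deriv_eq_zero hc
  have hconst : f =ᶠ[𝓝 t] fun _ => f t := by
    filter_upwards [h, hmin] with s hle hge using le_antisymm hle hge
  have hderiv : deriv f =ᶠ[𝓝 t] fun _ => 0 := by simpa using hconst.deriv
  simp [hderiv.deriv_eq] at hpos

theorem posSemidef_neg_hessian_of_isLocalMax {φ : Rn n → ℝ} {x : Rn n} (hφ : ContDiffAt ℝ 2 φ x)
    (h : IsLocalMax φ x) : (-hessian φ x).PosSemidef := by
  refine .of_dotProduct_mulVec_nonneg (hessian_isSelfAdjoint hφ).neg fun v => ?_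
  set u : Rn n := WithLp.toLp 2 v
  set line : ℝ → Rn n := fun t => x + t • u
  have hline (t : ℝ) : HasDerivAt line u t := by
    simpa [line] using ((hasDerivAt_id t).smul_const u).const_add x
  have hline0 : Filter.Tendsto line (𝓝 0) (𝓝 x) := by
    simpa [line] using (hline 0).continuousAt.tendsto
  have hx : line 0 = x := by simp [line]
  have hmax : IsLocalMax (φ ∘ line) 0 := by
    filter_upwards [hline0.eventually h] with t ht
    simpa [hx] using ht
  have hfst : deriv (φ ∘ line) =ᶠ[𝓝 0] fun t => fderiv ℝ φ (line t) u := by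
    filter_upwards [hline0.eventually (eventually_differentiableAt hφ)] with t ht
    exact (ht.hasFDerivAt.comp_hasDerivAt t (hline t)).deriv
  have hsnd : HasDerivAt (fun t => fderiv ℝ φ (line t) u) (fderiv ℝ (fderiv ℝ φ) x u u) 0 := by
    have hd : HasFDerivAt (fderiv ℝ φ) (fderiv ℝ (fderiv ℝ φ) x) (line 0) :=
      hx.symm ▸ (differentiableAt_fderiv hφ).hasFDerivAt
    simpa using (hd.comp_hasDerivAt (0 : ℝ) (hline 0)).clm_apply (hasDerivAt_const (0 : ℝ) u)
  have hle := deriv_deriv_nonpos_of_isLocalMax hmax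
    (ContinuousAt.comp (hx.symm ▸ hφ.continuousAt) (hline 0).continuousAt)
  rw [hfst.deriv_eq, hsnd.deriv, fderiv_fderiv_apply] at hle
  rw [Matrix.neg_mulVec, dotProduct_neg, Left.nonneg_neg_iff]
  refine le_trans (le_of_eq ?_) hle
  simp only [dotProduct, Matrix.mulVec, Finset.mul_sum, star_trivial]
  exact Finset.sum_congr rfl fun i _ => Finset.sum_congr rfl fun j _ => by simp only [u]; ring

/-! ### Viscosity subharmonic functions -/

section Subharmonic

variable {F F' : Set (SymMat n)} {X : Set (Rn n)} {u v : Rn n → EReal}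

theorem IsSubharmonic.mono (hu : IsSubharmonic F X u) (hF : F ⊆ F') : IsSubharmonic F' X u where
  usc := hu.usc
  lt_top := hu.lt_top
  viscosity x hx φ hφ hle heq :=
    let ⟨A, hA, h⟩ := hu.viscosity x hx φ hφ hle heq
    ⟨A, hF hA, h⟩

theorem IsSubharmonic.congr (hX : IsOpen X) (hu : IsSubharmonic F X u) (h : Set.EqOn v u X) :
    IsSubharmonic F X v where
  usc x hx := UpperSemicontinuousWithinAt.congr_of_eventuallyEq (hu.usc x hx) hx
    (h.symm.eventuallyEq_of_mem self_mem_nhdsWithin)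
  lt_top x hx := h hx ▸ hu.lt_top x hx
  viscosity x hx φ hφ hle heq := by
    refine hu.viscosity x hx φ hφ ?_ (h hx ▸ heq)
    filter_upwards [hle, hX.mem_nhds hx] with y hy hyX
    exact h hyX ▸ hy

theorem IsSubharmonic.max (hu : IsSubharmonic F X u) (hv : IsSubharmonic F X v) :
    IsSubharmonic F X fun x => u x ⊔ v x where
  usc := hu.usc.sup hv.usc
  lt_top x hx := max_lt (hu.lt_top x hx) (hv.lt_top x hx)
  viscosity x hx φ hφ hle heq := by
    rcases max_choice (u x) (v x) with h | h
    · exact hu.viscosity x hx φ hφ (hle.mono fun y => le_sup_left.trans) (h.symm.trans heq)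
    · exact hv.viscosity x hx φ hφ (hle.mono fun y => le_sup_right.trans) (h.symm.trans heq)

theorem IsSubequation.isSubharmonic_of_contDiffAt (hF : IsSubequation F) {u : Rn n → ℝ}
    (hu : ∀ x ∈ X, ContDiffAt ℝ 2 u x)
    (hmem : ∀ x ∈ X, ∃ A ∈ F, (A : Matrix (Fin n) (Fin n) ℝ) = hessian u x) :
    IsSubharmonic F X fun y => (u y : EReal) where
  usc x hx := ((continuous_coe_real_ereal.continuousAt.comp
    (hu x hx).continuousAt).continuousWithinAt).upperSemicontinuousWithinAt
  lt_top _ _ := EReal.coe_lt_top _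
  viscosity x hx φ hφ hle heq := by
    have hmax : IsLocalMax (fun y => u y - φ y) x := by
      filter_upwards [hle] with y hy
      have huφ : u x = φ x := EReal.coe_injective heq
      have hyφ : u y ≤ φ y := EReal.coe_le_coe_iff.1 hy
      linarith
    have hP := posSemidef_neg_hessian_of_isLocalMax ((hu x hx).sub hφ) hmax
    obtain ⟨A, hA, hAu⟩ := hmem x hx
    refine ⟨A + ⟨_, hP.isHermitian⟩, hF.positivity A hA _ hP, ?_⟩
    simp [hAu, hessian_sub (hu x hx) hφ]

end Subharmonic

theorem exists_touching {α : Type*} [TopologicalSpace α] {K : Set α} (hK : IsCompact K)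
    {w : α → EReal} (hw : UpperSemicontinuousOn w K) (hlt : ∀ y ∈ K, w y < ⊤)
    {φ : α → ℝ} (hφ : ContinuousOn φ K) (hbd : ∀ y ∈ frontier K ∩ K, w y ≤ φ y) {x₀ : α}
    (hx₀ : x₀ ∈ K) (h : (φ x₀ : EReal) < w x₀) :
    ∃ x ∈ interior K, ∃ m : ℝ, w x = (φ x + m : ℝ) ∧ ∀ y ∈ K, w y ≤ (φ y + m : ℝ) := by
  have husc : UpperSemicontinuousOn (fun y => w y + ((-φ y : ℝ) : EReal)) K :=
    hw.add' (continuous_coe_real_ereal.comp_continuousOn hφ.neg).upperSemicontinuousOn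
      fun y _ => EReal.continuousAt_add (.inr (EReal.coe_ne_bot _)) (.inr (EReal.coe_ne_top _))
  have hdiff (y : α) : w y + ((-φ y : ℝ) : EReal) = w y - φ y := by
    rw [EReal.coe_neg, sub_eq_add_neg]
  simp only [hdiff] at husc
  obtain ⟨x, hxK, hx⟩ := husc.exists_isMaxOn ⟨x₀, hx₀⟩ hK
  have hpos : (φ x : EReal) < w x := by
    rw [← EReal.sub_pos] at h ⊢
    exact h.trans_le (hx hx₀)
  have hreal : ((w x).toReal : EReal) = w x := EReal.coe_toReal (hlt x hxK).ne hpos.ne_bot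
  refine ⟨x, ?_, (w x).toReal - φ x, by rw [add_sub_cancel, hreal], fun y hy => ?_⟩
  · by_contra hxi
    exact hpos.not_ge (hbd x ⟨⟨subset_closure hxK, hxi⟩, hxK⟩)
  · have hmax : w y - φ y ≤ w x - φ x := hx hy
    rw [EReal.sub_le_iff_le_add (.inl (EReal.coe_ne_bot _)) (.inl (EReal.coe_ne_top _))] at hmax
    rwa [add_comm, EReal.coe_add, EReal.coe_sub, hreal]

theorem IsSubharmonic.le_of_le_on_frontier_of_notMem {P : Set (SymMat n)} {X K : Set (Rn n)}
    {w : Rn n → EReal} (hw : IsSubharmonic P X w) (hK : IsCompact K) (hKX : K ⊆ X) {φ : Rn n → ℝ}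
    (hφ : ContinuousOn φ K) (hφ₂ : ∀ x ∈ interior K, ContDiffAt ℝ 2 φ x)
    (hnot : ∀ x ∈ interior K, ∀ A ∈ P, (A : Matrix (Fin n) (Fin n) ℝ) ≠ hessian φ x)
    (hbd : ∀ y ∈ frontier K, w y ≤ φ y) : ∀ y ∈ K, w y ≤ φ y := by
  intro x₀ hx₀
  by_contra! hcon
  obtain ⟨x, hx, m, hxm, hle⟩ := exists_touching hK (hw.usc.mono hKX)
    (fun y hy => hw.lt_top y (hKX hy)) hφ (fun y hy => hbd y hy.1) hx₀ hcon
  obtain ⟨A, hA, hAφ⟩ := hw.viscosity x (hKX (interior_subset hx)) (fun y => φ y + m)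
    ((hφ₂ x hx).add contDiffAt_const)
    (Filter.mem_of_superset (isOpen_interior.mem_nhds hx) fun y hy => hle y (interior_subset hy))
    hxm
  refine hnot x hx A hA (hAφ.trans ?_)
  rw [hessian_add (hφ₂ x hx) contDiffAt_const, hessian_const, add_zero]

theorem IsSubharmonic.le_of_le_on_frontier {P : Set (SymMat n)} {X K : Set (Rn n)}
    {w : Rn n → EReal} (hw : IsSubharmonic P X w) (hK : IsCompact K) (hKX : K ⊆ X) {φ : Rn n → ℝ}
    (hφ : ContinuousOn φ K) (hφ₂ : ∀ x ∈ interior K, ContDiffAt ℝ 2 φ x)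
    (hstrict : ∀ x ∈ interior K, ∀ ε > (0 : ℝ), ∀ A ∈ P,
      (A : Matrix (Fin n) (Fin n) ℝ) ≠ hessian φ x - ε • 1)
    (hbd : ∀ y ∈ frontier K, w y ≤ φ y) : ∀ y ∈ K, w y ≤ φ y := by
  intro x₀ hx₀
  by_contra! hcon
  obtain ⟨c, hφc, hcw⟩ := EReal.lt_iff_exists_real_btwn.1 hcon
  obtain ⟨R, hR⟩ := hK.isBounded.exists_norm_le
  obtain ⟨ε, hε, hεR⟩ : ∃ ε > 0, ε * R ^ 2 < c - φ x₀ := by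
    have := sub_pos.2 (EReal.coe_lt_coe_iff.1 hφc)
    exact ⟨(c - φ x₀) / (R ^ 2 + 1), by positivity, by
      rw [div_mul_eq_mul_div, div_lt_iff₀ (by positivity)]
      nlinarith⟩
  -- Lowering the Hessian of `φ` by a multiple of the identity makes it inadmissible.
  set κ : Rn n → ℝ := fun y => ε * R ^ 2 + -ε * ‖y - 0‖ ^ 2
  have hκ : ContDiff ℝ 2 κ := contDiff_const.add (contDiff_mul_norm_sub_sq _ _)
  have hκ_nonneg (y : Rn n) (hy : y ∈ K) : 0 ≤ κ y := by
    have : ‖y - 0‖ ^ 2 ≤ R ^ 2 := by simpa using pow_le_pow_left₀ (norm_nonneg y) (hR y hy) 2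
    simp only [κ]
    nlinarith
  have hκ_lt : φ x₀ + κ x₀ < c := by
    have : 0 ≤ ε * ‖x₀ - 0‖ ^ 2 := by positivity
    simp only [κ]
    linarith
  have hle := hw.le_of_le_on_frontier_of_notMem hK hKX (hφ.add hκ.continuous.continuousOn)
    (fun x hx => (hφ₂ x hx).add hκ.contDiffAt) (fun x hx A hA hAκ => ?_)
    (fun y hy => (hbd y hy).trans (EReal.coe_le_coe_iff.2
      (le_add_of_nonneg_right (hκ_nonneg y (hK.isClosed.frontier_subset hy)))))
    x₀ hx₀
  · exact (hcw.trans_le hle).not_ge (EReal.coe_le_coe_iff.2 hκ_lt.le)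
  · refine hstrict x hx (2 * ε) (by positivity) A hA (hAκ.trans ?_)
    rw [Pi.add_def, hessian_add (hφ₂ x hx) hκ.contDiffAt,
      hessian_add contDiffAt_const (contDiff_mul_norm_sub_sq _ _).contDiffAt, hessian_const,
      hessian_mul_norm_sub_sq, zero_add, sub_eq_add_neg, ← neg_smul, mul_neg]

theorem IsSubharmonic.nonempty_of_ne_bot {P : Set (SymMat n)} {X : Set (Rn n)}
    (hX : IsOpen X) {w : Rn n → EReal} (hw : IsSubharmonic P X w) {x₀ : Rn n} (hx₀ : x₀ ∈ X)
    (hbot : w x₀ ≠ ⊥) : P.Nonempty := by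
  by_contra! hP
  obtain ⟨r, hr, hrX⟩ := Metric.nhds_basis_closedBall.mem_iff.1 (hX.mem_nhds hx₀)
  have hx₀r := Metric.mem_closedBall_self hr.le (x := x₀)
  have hreal (x : Rn n) (hx : x ∈ Metric.closedBall x₀ r) (hwx : w x₀ ≤ w x) :
      ((w x).toReal : EReal) = w x :=
    EReal.coe_toReal (hw.lt_top x (hrX hx)).ne fun h => hbot (le_bot_iff.1 (h ▸ hwx))
  obtain ⟨z, hz, hzmax⟩ :=
    (hw.usc.mono hrX).exists_isMaxOn ⟨x₀, hx₀r⟩ (isCompact_closedBall x₀ r)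
  set s := (w x₀).toReal
  set M := (w z).toReal
  -- With no admissible Hessian, `w` lies below every paraboloid which dominates it on the sphere.
  set φ : Rn n → ℝ := fun y => (s - 1) + (M - s + 1) / r ^ 2 * ‖y - x₀‖ ^ 2
  have hφ : ContDiff ℝ 2 φ := contDiff_const.add (contDiff_mul_norm_sub_sq _ _)
  have hle := hw.le_of_le_on_frontier_of_notMem (isCompact_closedBall x₀ r) hrX
    hφ.continuous.continuousOn (fun x _ => hφ.contDiffAt) (by simp [hP]) (fun y hy => by
      rw [frontier_closedBall x₀ hr.ne', mem_sphere_iff_norm] at hy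
      refine (hzmax (mem_closedBall_iff_norm.2 hy.le)).trans ?_
      rw [← hreal z hz (hzmax hx₀r), EReal.coe_le_coe_iff]
      simp only [φ, hy]
      field_simp
      linarith) x₀ hx₀r
  rw [← hreal x₀ hx₀r le_rfl, EReal.coe_le_coe_iff] at hle
  simp only [φ, sub_self, norm_zero] at hle
  linarith

/-- The linear subequation `{A : 0 ≤ ℓ A}`. -/
def halfSpace (ℓ : Matrix (Fin n) (Fin n) ℝ →ₗ[ℝ] ℝ) : Set (SymMat n) :=
  {A | 0 ≤ ℓ A}

/-- Degenerate ellipticity and nontriviality of the constant coefficient operator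
`u ↦ ℓ (D²u)`. -/
structure IsElliptic (ℓ : Matrix (Fin n) (Fin n) ℝ →ₗ[ℝ] ℝ) : Prop where
  nonneg : ∀ P : Matrix (Fin n) (Fin n) ℝ, P.PosSemidef → 0 ≤ ℓ P
  one_pos : 0 < ℓ 1

section HalfSpace

variable {ℓ : Matrix (Fin n) (Fin n) ℝ →ₗ[ℝ] ℝ} {X : Set (Rn n)}

theorem isCone_halfSpace (ℓ : Matrix (Fin n) (Fin n) ℝ →ₗ[ℝ] ℝ) : IsCone (halfSpace ℓ) :=
  fun t ht A hA => by simpa [halfSpace] using mul_nonneg ht hA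

theorem IsElliptic.isSubequation_halfSpace (hℓ : IsElliptic ℓ) : IsSubequation (halfSpace ℓ) where
  isClosed := isClosed_le continuous_const
    (ℓ.continuous_of_finiteDimensional.comp continuous_subtype_val)
  positivity A hA P hP := by simpa [halfSpace] using add_nonneg hA (hℓ.nonneg P hP)

theorem exists_mem_halfSpace_eq_hessian {φ : Rn n → ℝ} {x : Rn n} (hφ : ContDiffAt ℝ 2 φ x)
    (h : 0 ≤ ℓ (hessian φ x)) :
    ∃ A ∈ halfSpace ℓ, (A : Matrix (Fin n) (Fin n) ℝ) = hessian φ x :=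
  ⟨⟨_, hessian_isSelfAdjoint hφ⟩, h, rfl⟩

theorem IsElliptic.isSubharmonic_of_contDiffAt (hℓ : IsElliptic ℓ) {u : Rn n → ℝ}
    (hu : ∀ x ∈ X, ContDiffAt ℝ 2 u x) (h : ∀ x ∈ X, 0 ≤ ℓ (hessian u x)) :
    IsSubharmonic (halfSpace ℓ) X fun y => (u y : EReal) :=
  hℓ.isSubequation_halfSpace.isSubharmonic_of_contDiffAt hu fun x hx =>
    exists_mem_halfSpace_eq_hessian (hu x hx) (h x hx)

theorem IsElliptic.le_on_closedBall (hℓ : IsElliptic ℓ) {w : Rn n → EReal}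
    (hw : IsSubharmonic (halfSpace ℓ) X w) {r : ℝ} (hr : r ≠ 0)
    (hX : Metric.closedBall 0 r ⊆ X) {h : Rn n → ℝ} (hh : ContDiff ℝ 2 h)
    (hℓh : ∀ x, ℓ (hessian h x) ≤ 0) (hbd : ∀ y ∈ Metric.sphere (0 : Rn n) r, w y ≤ h y) :
    ∀ y ∈ Metric.closedBall (0 : Rn n) r, w y ≤ h y := by
  refine hw.le_of_le_on_frontier (isCompact_closedBall 0 r) hX hh.continuous.continuousOn
    (fun x _ => hh.contDiffAt) (fun x _ ε hε A hA hAh => ?_)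
    (by rwa [frontier_closedBall _ hr])
  have hA' : 0 ≤ ℓ A := hA
  rw [hAh, map_sub, map_smul, smul_eq_mul] at hA'
  nlinarith [hℓh x, mul_pos hε hℓ.one_pos]

end HalfSpace

/-! ### The Dirichlet problem for polynomials on balls -/

/-- The polynomial function on `ℝⁿ` defined by a polynomial in the coordinates. -/
def polyFun : MvPolynomial (Fin n) ℝ →ₐ[ℝ] (Rn n → ℝ) :=
  MvPolynomial.aeval fun i x => x i

theorem polyFun_C (a : ℝ) : polyFun (MvPolynomial.C a : MvPolynomial (Fin n) ℝ) = fun _ => a :=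
  MvPolynomial.aeval_C _ a

theorem polyFun_X (i : Fin n) :
    polyFun (MvPolynomial.X i) = (EuclideanSpace.proj i : Rn n →L[ℝ] ℝ) :=
  MvPolynomial.aeval_X _ i

theorem polyFun_apply (p : MvPolynomial (Fin n) ℝ) (x : Rn n) :
    polyFun p x = MvPolynomial.eval x.ofLp p := by
  induction p using MvPolynomial.induction_on with
  | C a => simp
  | add p q hp hq => simp [hp, hq]
  | mul_X p i hp => simp [hp, polyFun_X]

theorem contDiff_polyFun (p : MvPolynomial (Fin n) ℝ) {m : WithTop ℕ∞} :
    ContDiff ℝ m (polyFun p) := by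
  induction p using MvPolynomial.induction_on with
  | C a => rw [polyFun_C]; exact contDiff_const
  | add p q hp hq => rw [map_add]; exact hp.add hq
  | mul_X p i hp =>
    rw [map_mul]
    exact hp.mul (polyFun_X i ▸ ContinuousLinearMap.contDiff _)

theorem fderiv_polyFun (p : MvPolynomial (Fin n) ℝ) (x : Rn n) (j : Fin n) :
    fderiv ℝ (polyFun p) x (EuclideanSpace.single j 1) = polyFun (MvPolynomial.pderiv j p) x := by
  have hd (q : MvPolynomial (Fin n) ℝ) : DifferentiableAt ℝ (polyFun q) x :=
    (contDiff_polyFun q).differentiable one_ne_zero x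
  induction p using MvPolynomial.induction_on with
  | C a => rw [polyFun_C]; simp
  | add p q hp hq => simp [fderiv_add (hd p) (hd q), hp, hq]
  | mul_X p i hp =>
    rw [map_mul, fderiv_mul (hd p) (hd _), polyFun_X, ContinuousLinearMap.fderiv]
    by_cases h : i = j
    · subst h
      simp [hp, polyFun_X]
    · simp [hp, polyFun_X, MvPolynomial.pderiv_X, h]

theorem hessian_polyFun (p : MvPolynomial (Fin n) ℝ) (x : Rn n) (i j : Fin n) :
    hessian (polyFun p) x i j = polyFun (MvPolynomial.pderiv i (MvPolynomial.pderiv j p)) x := by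
  have hj : polyFun (MvPolynomial.pderiv j p) =
      fun y => fderiv ℝ (polyFun p) y (EuclideanSpace.single j 1) :=
    funext fun y => (fderiv_polyFun p y j).symm
  rw [← fderiv_polyFun, hj, fderiv_clm_apply
    (differentiableAt_fderiv (contDiff_polyFun p).contDiffAt) (differentiableAt_const _)]
  simp [hessian]

/-- The constant coefficient operator `p ↦ ℓ (D²p)` on polynomials. -/
def polyOp (ℓ : Matrix (Fin n) (Fin n) ℝ →ₗ[ℝ] ℝ) :
    MvPolynomial (Fin n) ℝ →ₗ[ℝ] MvPolynomial (Fin n) ℝ :=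
  ∑ i, ∑ j, ℓ (Matrix.single i j 1) •
    ((MvPolynomial.pderiv i).toLinearMap ∘ₗ (MvPolynomial.pderiv j).toLinearMap)

theorem polyOp_C (ℓ : Matrix (Fin n) (Fin n) ℝ →ₗ[ℝ] ℝ) (c : ℝ) :
    polyOp ℓ (MvPolynomial.C c) = 0 := by
  simp [polyOp]

theorem polyFun_polyOp (ℓ : Matrix (Fin n) (Fin n) ℝ →ₗ[ℝ] ℝ) (p : MvPolynomial (Fin n) ℝ)
    (x : Rn n) : polyFun (polyOp ℓ p) x = ℓ (hessian (polyFun p) x) := by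
  have hsingle (i j : Fin n) (c : ℝ) :
      ℓ (Matrix.single i j c) = c * ℓ (Matrix.single i j 1) := by
    rw [← smul_eq_mul, ← map_smul, Matrix.smul_single, smul_eq_mul, mul_one]
  conv_rhs => rw [Matrix.matrix_eq_sum_single (hessian (polyFun p) x)]
  simp only [map_sum, hessian_polyFun]
  simp_rw [hsingle _ _ (polyFun _ x)]
  simp [polyOp, mul_comm]

theorem pderiv_mem_restrictTotalDegree {σ R : Type*} [CommSemiring R] {k : ℕ} (i : σ)
    {p : MvPolynomial σ R} (hp : p ∈ MvPolynomial.restrictTotalDegree σ R (k + 1)) :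
    MvPolynomial.pderiv i p ∈ MvPolynomial.restrictTotalDegree σ R k := by
  rw [MvPolynomial.mem_restrictTotalDegree] at hp
  rw [p.as_sum, map_sum]
  refine Submodule.sum_mem _ fun s hs => ?_
  rw [MvPolynomial.mem_restrictTotalDegree, MvPolynomial.pderiv_monomial]
  by_cases hsi : s i = 0
  · simp [hsi]
  have hsub : Finsupp.single i 1 ≤ s := by
    rw [Finsupp.single_le_iff]
    omega
  have hdeg : (s - Finsupp.single i 1).degree + 1 = s.degree := by
    conv_rhs => rw [← tsub_add_cancel_of_le hsub, map_add, Finsupp.degree_single]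
  have hsp : s.degree ≤ p.totalDegree := MvPolynomial.le_totalDegree hs
  have hmono : (MvPolynomial.monomial (s - Finsupp.single i 1) (p.coeff s * s i)).totalDegree ≤
      (s - Finsupp.single i 1).degree := MvPolynomial.totalDegree_monomial_le _ _
  omega

theorem polyOp_mem_restrictTotalDegree {k : ℕ} (ℓ : Matrix (Fin n) (Fin n) ℝ →ₗ[ℝ] ℝ)
    {p : MvPolynomial (Fin n) ℝ}
    (hp : p ∈ MvPolynomial.restrictTotalDegree (Fin n) ℝ (k + 2)) :
    polyOp ℓ p ∈ MvPolynomial.restrictTotalDegree (Fin n) ℝ k := by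
  simp only [polyOp, LinearMap.sum_apply, LinearMap.smul_apply]
  exact Submodule.sum_mem _ fun i _ => Submodule.sum_mem _ fun j _ => Submodule.smul_mem _ _
    (pderiv_mem_restrictTotalDegree i (pderiv_mem_restrictTotalDegree j hp))

/-- The polynomial `1 - |x|²`, which vanishes on the unit sphere. -/
def ballPoly (n : ℕ) : MvPolynomial (Fin n) ℝ := 1 - ∑ i, MvPolynomial.X i ^ 2

theorem polyFun_ballPoly_mul (q : MvPolynomial (Fin n) ℝ) (x : Rn n) :
    polyFun (ballPoly n * q) x = (1 - ‖x‖ ^ 2) * polyFun q x := by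
  simp [polyFun_apply, ballPoly, EuclideanSpace.norm_sq_eq]

theorem totalDegree_ballPoly_le (n : ℕ) : (ballPoly n).totalDegree ≤ 2 := by
  refine (MvPolynomial.totalDegree_sub _ _).trans (max_le (by simp) ?_)
  exact MvPolynomial.totalDegree_finsetSum_le fun i _ =>
    (MvPolynomial.totalDegree_pow _ _).trans (by simp)

theorem eq_zero_of_polyFun_eq_zero_on_ball {q : MvPolynomial (Fin n) ℝ}
    (h : ∀ x ∈ Metric.ball (0 : Rn n) 1, polyFun q x = 0) : q = 0 := by
  obtain ⟨ε, hε, hsub⟩ := Metric.isOpen_iff.1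
    ((PiLp.continuous_toLp 2 fun _ : Fin n => ℝ).isOpen_preimage _
      (Metric.isOpen_ball (x := (0 : Rn n)) (ε := 1))) 0 (by simp)
  refine MvPolynomial.funext_set (fun _ => Metric.ball (0 : ℝ) ε) (fun _ => ?_) fun x hx => ?_
  · rw [Real.ball_eq_Ioo]
    exact Set.Ioo_infinite (by linarith)
  · rw [← ball_pi _ hε] at hx
    simpa [polyFun_apply] using h (WithLp.toLp 2 x) (hsub hx)

section Dirichlet

variable {ℓ : Matrix (Fin n) (Fin n) ℝ →ₗ[ℝ] ℝ}

theorem IsElliptic.polyFun_le_of_le_on_sphere (hℓ : IsElliptic ℓ) {H : MvPolynomial (Fin n) ℝ}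
    (hH : polyOp ℓ H = 0) {c : ℝ} (hc : ∀ x ∈ Metric.sphere (0 : Rn n) 1, polyFun H x ≤ c) :
    ∀ x ∈ Metric.closedBall (0 : Rn n) 1, polyFun H x ≤ c := by
  have hsub : IsSubharmonic (halfSpace ℓ) Set.univ fun y => (polyFun H y : EReal) :=
    hℓ.isSubharmonic_of_contDiffAt (fun x _ => (contDiff_polyFun H).contDiffAt) fun x _ => by
      simp [← polyFun_polyOp, hH]
  have := hℓ.le_on_closedBall (h := fun _ => c) hsub one_ne_zero (Set.subset_univ _) contDiff_const
    (fun x => by simp [hessian_const]) fun y hy => EReal.coe_le_coe_iff.2 (hc y hy)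
  exact fun x hx => EReal.coe_le_coe_iff.1 (this x hx)

theorem IsElliptic.polyFun_eq_zero_of_eq_zero_on_sphere (hℓ : IsElliptic ℓ)
    {H : MvPolynomial (Fin n) ℝ} (hH : polyOp ℓ H = 0)
    (h₀ : ∀ x ∈ Metric.sphere (0 : Rn n) 1, polyFun H x = 0) :
    ∀ x ∈ Metric.closedBall (0 : Rn n) 1, polyFun H x = 0 := fun x hx =>
  le_antisymm (hℓ.polyFun_le_of_le_on_sphere hH (fun y hy => (h₀ y hy).le) x hx) <| by
    have := hℓ.polyFun_le_of_le_on_sphere (H := -H) (c := 0) (by rw [map_neg, hH, neg_zero])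
      (fun y hy => by simp [h₀ y hy]) x hx
    simpa using this

theorem IsElliptic.polyOp_ballPoly_mul_injective (hℓ : IsElliptic ℓ)
    {q : MvPolynomial (Fin n) ℝ} (hq : polyOp ℓ (ballPoly n * q) = 0) : q = 0 := by
  refine eq_zero_of_polyFun_eq_zero_on_ball fun x hx => ?_
  have h₀ := hℓ.polyFun_eq_zero_of_eq_zero_on_sphere hq
    (fun y hy => by simp [polyFun_ballPoly_mul, mem_sphere_zero_iff_norm.1 hy]) x
    (Metric.ball_subset_closedBall hx)
  rw [polyFun_ballPoly_mul] at h₀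
  have : ‖x‖ ^ 2 < 1 := (sq_lt_one_iff₀ (norm_nonneg x)).2 (mem_ball_zero_iff.1 hx)
  exact (mul_eq_zero.1 h₀).resolve_left (sub_pos.2 this).ne'

theorem IsElliptic.exists_polyOp_eq_zero_eq_on_sphere (hℓ : IsElliptic ℓ)
    (p : MvPolynomial (Fin n) ℝ) :
    ∃ H, polyOp ℓ H = 0 ∧ ∀ x ∈ Metric.sphere (0 : Rn n) 1, polyFun H x = polyFun p x := by
  set k := p.totalDegree
  set V := MvPolynomial.restrictTotalDegree (Fin n) ℝ k
  have hmaps (q : MvPolynomial (Fin n) ℝ) (hq : q ∈ V) : polyOp ℓ (ballPoly n * q) ∈ V := by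
    refine polyOp_mem_restrictTotalDegree ℓ ?_
    rw [MvPolynomial.mem_restrictTotalDegree] at hq ⊢
    linarith [MvPolynomial.totalDegree_mul (ballPoly n) q, totalDegree_ballPoly_le n]
  -- Injectivity gives surjectivity, as the space of polynomials of degree at most `k` has finite
  -- dimension.
  let T : V →ₗ[ℝ] V := (polyOp ℓ ∘ₗ LinearMap.mulLeft ℝ (ballPoly n)).restrict hmaps
  have hT : Function.Injective T := by
    rw [← LinearMap.ker_eq_bot, LinearMap.ker_eq_bot']
    exact fun q hq => Subtype.ext (hℓ.polyOp_ballPoly_mul_injective (congrArg Subtype.val hq))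
  obtain ⟨q, hq⟩ := LinearMap.injective_iff_surjective.1 hT
    ⟨polyOp ℓ p, polyOp_mem_restrictTotalDegree ℓ (by
      rw [MvPolynomial.mem_restrictTotalDegree]
      omega)⟩
  have hq' : polyOp ℓ (ballPoly n * q) = polyOp ℓ p := congrArg Subtype.val hq
  refine ⟨p - ballPoly n * q, by rw [map_sub, hq', sub_self], fun x hx => ?_⟩
  rw [map_sub, Pi.sub_apply, polyFun_ballPoly_mul, mem_sphere_zero_iff_norm.1 hx]
  simp

end Dirichlet

theorem exists_measure_integral_eq {S V : Type*} [TopologicalSpace S] [CompactSpace S] [T2Space S]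
    [MeasurableSpace S] [BorelSpace S] [AddCommGroup V] [Module ℝ V] (R : V →ₗ[ℝ] C(S, ℝ))
    (L : V →ₗ[ℝ] ℝ) (hL : ∀ v, 0 ≤ R v → 0 ≤ L v) {e : V} (he : R e = 1) (hLe : L e = 1) :
    ∃ μ : Measure S, IsProbabilityMeasure μ ∧ ∀ v, ∫ σ, R v σ ∂μ = L v := by
  have hker : LinearMap.ker R ≤ LinearMap.ker L := fun v hv => by
    rw [LinearMap.mem_ker] at hv ⊢
    have hneg := hL (-v) (by rw [map_neg, hv, neg_zero])
    rw [map_neg] at hneg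
    linarith [hL v hv.ge]
  let f : C(S, ℝ) →ₗ.[ℝ] ℝ :=
    ⟨LinearMap.range R, (LinearMap.ker R).liftQ L hker ∘ₗ R.quotKerEquivRange.symm.toLinearMap⟩
  have hf (v : V) : f ⟨R v, LinearMap.mem_range_self R v⟩ = L v :=
    congrArg ((LinearMap.ker R).liftQ L hker) (R.quotKerEquivRange_symm_apply_image v _)
  obtain ⟨Λ, hΛf, hΛ⟩ := riesz_extension (PointedCone.positive ℝ C(S, ℝ)) f
    (fun ⟨_, v, hv⟩ hg => by
      subst hv
      exact hf v ▸ hL v hg)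
    fun g => ⟨⟨R (‖g‖ • e), _, rfl⟩, fun σ => by
      have := neg_le_of_abs_le (g.norm_coe_le_norm σ)
      simp [he]
      linarith⟩
  let Ψ : CompactlySupportedContinuousMap S ℝ →ₚ[ℝ] ℝ := PositiveLinearMap.mk₀
    (Λ ∘ₗ
      { toFun := fun g => g.toContinuousMap
        map_add' := fun _ _ => rfl
        map_smul' := fun _ _ => rfl }) fun g hg => hΛ _ hg
  have hintegral (v : V) : ∫ σ, R v σ ∂(RealRMK.rieszMeasure Ψ) = L v :=
    (RealRMK.integral_rieszMeasure Ψ ⟨R v, HasCompactSupport.of_compactSpace _⟩).trans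
      ((hΛf ⟨R v, v, rfl⟩).trans (hf v))
  refine ⟨_, ⟨?_⟩, hintegral⟩
  have hmass := hintegral e
  simpa [he, hLe, measureReal_def, ENNReal.toReal_eq_one_iff] using hmass

theorem isLUB_continuous_le_of_lowerSemicontinuous {S : Type*} [TopologicalSpace S]
    [CompletelyRegularSpace S] {D : S → ENNReal} (hD : LowerSemicontinuous D) :
    IsLUB {f | ∃ d : C(S, NNReal), f = (fun σ => (d σ : ENNReal)) ∧ f ≤ D} D := by
  refine ⟨fun _ ⟨_, _, hf⟩ => hf, fun e he x => ENNReal.le_of_forall_nnreal_lt fun a ha => ?_⟩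
  obtain ⟨f, hf, hfx, hf1⟩ := CompletelyRegularSpace.completely_regular_isOpen x {y | a < D y}
    (hD.isOpen_preimage a) ha
  let d : C(S, NNReal) :=
    ⟨fun y => a * (1 - (f y : ℝ)).toNNReal, by fun_prop⟩
  have hd : (fun y => (d y : ENNReal)) ≤ D := fun y => by
    by_cases hy : a < D y
    · refine le_trans ?_ hy.le
      have : (1 - (f y : ℝ)).toNNReal ≤ 1 := by simpa using (f y).2.1
      exact ENNReal.coe_le_coe.2 (mul_le_of_le_one_right' this)
    · simp [d, hf1 hy]
  simpa [d, hfx] using he ⟨d, rfl, hd⟩ x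

theorem lintegral_le_of_forall_continuous_le {S : Type*} [TopologicalSpace S]
    [CompletelyRegularSpace S] [SecondCountableTopology S] [MeasurableSpace S]
    [OpensMeasurableSpace S] {μ : Measure S} {D : S → ENNReal} (hD : LowerSemicontinuous D)
    {c : ENNReal}
    (h : ∀ d : C(S, NNReal), (∀ σ, d σ ≤ D σ) → ∫⁻ σ, d σ ∂μ ≤ c) :
    ∫⁻ σ, D σ ∂μ ≤ c := by
  obtain ⟨𝓕, h𝓕, hcount, hlub⟩ := exists_countable_lowerSemicontinuous_isLUB
    (by
      rintro _ ⟨d, rfl, -⟩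
      exact (ENNReal.continuous_coe.comp d.continuous).lowerSemicontinuous)
    (isLUB_continuous_le_of_lowerSemicontinuous hD)
  obtain ⟨f, hf⟩ := (hcount.insert 0).exists_eq_range (Set.insert_nonempty 0 𝓕)
  have hf𝓕 (k : ℕ) : ∃ d : C(S, NNReal), f k = (fun σ => (d σ : ENNReal)) ∧ f k ≤ D := by
    rcases hf ▸ Set.mem_range_self k with h0 | hk
    · exact ⟨0, h0, h0 ▸ fun _ => zero_le⟩
    · exact h𝓕 hk
  choose d hd hdD using hf𝓕
  have hsup (k : ℕ) (σ : S) : (partialSups d k σ : ENNReal) ≤ D σ :=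
    (partialSups_iff_forall (fun g : C(S, NNReal) => ∀ σ, (g σ : ENNReal) ≤ D σ)
      (by simp [forall_and])).2 (fun j _ σ => (congrFun (hd j) σ).symm.trans_le (hdD j σ)) σ
  have hD_le : D ≤ fun σ => ⨆ k, (partialSups d k σ : ENNReal) := hlub.2 fun g hg σ => by
    obtain ⟨k, rfl⟩ : g ∈ Set.range f := hf ▸ Set.mem_insert_of_mem 0 hg
    rw [hd k]
    exact le_iSup_of_le k (ENNReal.coe_le_coe.2 (le_partialSups d k σ))
  calc ∫⁻ σ, D σ ∂μ ≤ ∫⁻ σ, ⨆ k, (partialSups d k σ : ENNReal) ∂μ := lintegral_mono hD_le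
    _ = ⨆ k, ∫⁻ σ, (partialSups d k σ : ENNReal) ∂μ :=
      lintegral_iSup (fun k => (ENNReal.continuous_coe.comp (map_continuous _)).measurable)
        fun i j hij σ => ENNReal.coe_le_coe.2 (partialSups_monotone d hij σ)
    _ ≤ c := iSup_le fun k => h _ (hsup k)

/-! ### Harmonic measures and sub-mean values -/

/-- The amount by which `e` falls short of the bound `M`. Turning functions bounded above by `M`
into `[0, ∞]`-valued ones allows them to be integrated without integrability assumptions. -/
def deficit (M : ℝ) (e : EReal) : ENNReal := ((M : EReal) - e).toENNReal

theorem continuous_deficit (M : ℝ) : Continuous (deficit M) :=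
  EReal.continuous_toENNReal.comp <| continuous_iff_continuousAt.2 fun e =>
    (EReal.continuousAt_add (p := ((M : EReal), -e)) (.inl (EReal.coe_ne_top M))
      (.inl (EReal.coe_ne_bot M))).comp (f := fun e : EReal => ((M : EReal), -e))
      (continuousAt_const.prodMk continuous_neg.continuousAt)

theorem antitone_deficit (M : ℝ) : Antitone (deficit M) := fun _ _ h =>
  EReal.toENNReal_le_toENNReal (EReal.sub_le_sub le_rfl h)

theorem deficit_coe (M x : ℝ) : deficit M x = ENNReal.ofReal (M - x) := by
  rw [deficit, ← EReal.coe_sub, EReal.toENNReal_of_ne_top (EReal.coe_ne_top _), EReal.toReal_coe]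

theorem deficit_ne_top (M : ℝ) {e : EReal} (he : e ≠ ⊥) : deficit M e ≠ ⊤ := by
  induction e using EReal.rec with
  | bot => exact absurd rfl he
  | coe x => simp [deficit_coe]
  | top => simp [deficit]

theorem deficit_le_deficit_iff {M : ℝ} {e e' : EReal} (he' : e' ≤ M) :
    deficit M e ≤ deficit M e' ↔ e' ≤ e := by
  refine ⟨fun h => ?_, fun h => antitone_deficit M h⟩
  contrapose! h
  lift e' to ℝ using ⟨(he'.trans_lt (EReal.coe_lt_top M)).ne, h.ne_bot⟩
  induction e using EReal.rec with
  | bot => exact (deficit_coe M e').trans_lt (ENNReal.ofReal_lt_top.trans_eq (by simp [deficit]))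
  | top => exact absurd h not_top_lt
  | coe x =>
    have hx : x < e' := EReal.coe_lt_coe_iff.1 h
    have hM : e' ≤ M := EReal.coe_le_coe_iff.1 he'
    rw [deficit_coe, deficit_coe, ENNReal.ofReal_lt_ofReal_iff (by linarith)]
    linarith

/-- The unit sphere of `ℝⁿ`, as a type. -/
abbrev unitSphere (n : ℕ) : Type := Metric.sphere (0 : Rn n) 1

/-- Restriction of polynomial functions to the unit sphere. -/
def polySphere : MvPolynomial (Fin n) ℝ →ₐ[ℝ] C(unitSphere n, ℝ) :=
  MvPolynomial.aeval fun i => ⟨fun σ => (σ : Rn n) i, by fun_prop⟩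

theorem polySphere_apply (p : MvPolynomial (Fin n) ℝ) (σ : unitSphere n) :
    polySphere p σ = polyFun p σ := by
  have h : (Pi.evalAlgHom ℝ (fun _ => ℝ) (σ : Rn n)).comp polyFun =
      (ContinuousMap.evalAlgHom ℝ ℝ σ).comp polySphere :=
    MvPolynomial.algHom_ext fun i => by simp [polySphere, polyFun_X]
  exact (DFunLike.congr_fun h p).symm

theorem exists_polyFun_near (d : C(unitSphere n, ℝ)) {ε : ℝ} (hε : 0 < ε) :
    ∃ p : MvPolynomial (Fin n) ℝ, ∀ σ : unitSphere n, |polyFun p σ - d σ| < ε := by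
  have hsep : (polySphere (n := n)).range.SeparatesPoints := by
    intro x y hxy
    obtain ⟨i, hi⟩ : ∃ i, (x : Rn n) i ≠ (y : Rn n) i := by
      by_contra! h
      exact hxy (Subtype.ext (PiLp.ext h))
    exact ⟨_, ⟨polySphere (MvPolynomial.X i), ⟨_, rfl⟩, rfl⟩, by simpa [polySphere] using hi⟩
  obtain ⟨⟨_, p, rfl⟩, hp⟩ :=
    ContinuousMap.exists_mem_subalgebra_near_continuousMap_of_separatesPoints _ hsep d ε hε
  refine ⟨p, fun σ => ?_⟩
  simpa [polySphere_apply] using (ContinuousMap.norm_lt_iff _ hε).1 hp σ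

/-- `μ` represents the value at the center of the unit ball of every polynomial annihilated by the
operator `ℓ (D²·)` in terms of its values on the unit sphere. -/
def IsHarmonicMeasure (ℓ : Matrix (Fin n) (Fin n) ℝ →ₗ[ℝ] ℝ) (μ : Measure (unitSphere n)) : Prop :=
  ∀ H, polyOp ℓ H = 0 → ∫ σ : unitSphere n, polyFun H σ ∂μ = polyFun H 0

theorem IsElliptic.exists_isHarmonicMeasure
    {ℓ : Matrix (Fin n) (Fin n) ℝ →ₗ[ℝ] ℝ} (hℓ : IsElliptic ℓ) :
    ∃ μ : Measure (unitSphere n), IsProbabilityMeasure μ ∧ IsHarmonicMeasure ℓ μ := by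
  let R : LinearMap.ker (polyOp ℓ) →ₗ[ℝ] C(unitSphere n, ℝ) :=
    polySphere.toLinearMap ∘ₗ Submodule.subtype _
  let L : LinearMap.ker (polyOp ℓ) →ₗ[ℝ] ℝ :=
    LinearMap.proj 0 ∘ₗ polyFun.toLinearMap ∘ₗ Submodule.subtype _
  have hone : (1 : MvPolynomial (Fin n) ℝ) ∈ LinearMap.ker (polyOp ℓ) := polyOp_C ℓ 1
  have hR (H : LinearMap.ker (polyOp ℓ)) (σ : unitSphere n) : R H σ = polyFun H.1 σ :=
    polySphere_apply H.1 σ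
  obtain ⟨μ, hμ, hμL⟩ := exists_measure_integral_eq R L (fun H hH => by
      have := hℓ.polyFun_le_of_le_on_sphere (H := -H.1) (c := 0)
        (by rw [map_neg, neg_eq_zero]; exact H.2)
        (fun x hx => by simpa [hR] using hH ⟨x, hx⟩) 0 (by simp)
      simpa [L] using this)
    (e := ⟨1, hone⟩) (map_one polySphere) (congrFun (map_one polyFun) 0)
  exact ⟨μ, hμ, fun H hH => by
    simp only [hR] at hμL
    exact hμL ⟨H, hH⟩⟩

theorem IsElliptic.exists_polyOp_eq_zero_near_below
    {ℓ : Matrix (Fin n) (Fin n) ℝ →ₗ[ℝ] ℝ} (hℓ : IsElliptic ℓ) (d : C(unitSphere n, ℝ))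
    {ε : ℝ} (hε : 0 < ε) :
    ∃ H, polyOp ℓ H = 0 ∧ ∀ σ : unitSphere n, polyFun H σ ≤ d σ ∧ d σ ≤ polyFun H σ + ε := by
  obtain ⟨p, hp⟩ := exists_polyFun_near d (half_pos hε)
  obtain ⟨H, hH, hHp⟩ := hℓ.exists_polyOp_eq_zero_eq_on_sphere p
  refine ⟨H - MvPolynomial.C (ε / 2), by rw [map_sub, hH, polyOp_C, sub_zero], fun σ => ?_⟩
  have := abs_lt.1 (hp σ)
  rw [map_sub, polyFun_C, Pi.sub_apply, hHp _ σ.2]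
  constructor <;> linarith

section HarmonicMeasure

variable {ℓ : Matrix (Fin n) (Fin n) ℝ →ₗ[ℝ] ℝ} {μ : Measure (unitSphere n)}
  [IsProbabilityMeasure μ] {X : Set (Rn n)} {w : Rn n → EReal}

theorem IsHarmonicMeasure.lintegral_deficit_le_unit (hμ : IsHarmonicMeasure ℓ μ)
    (hℓ : IsElliptic ℓ) (hw : IsSubharmonic (halfSpace ℓ) X w) (hX : Metric.closedBall 0 1 ⊆ X)
    {M : ℝ} (hM : ∀ y ∈ Metric.closedBall (0 : Rn n) 1, w y ≤ M) :
    ∫⁻ σ : unitSphere n, deficit M (w σ) ∂μ ≤ deficit M (w 0) := by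
  have hlsc : LowerSemicontinuous fun σ : unitSphere n => deficit M (w σ) :=
    lowerSemicontinuous_restrict_iff.2 <|
      (continuous_deficit M).comp_upperSemicontinuousOn_antitone
        (hw.usc.mono (Metric.sphere_subset_closedBall.trans hX)) (antitone_deficit M)
  refine lintegral_le_of_forall_continuous_le hlsc fun d hd => ?_
  have hintegral (f : C(unitSphere n, ℝ)) : Integrable (fun σ => f σ) μ :=
    f.continuous.integrable_of_hasCompactSupport (HasCompactSupport.of_compactSpace _)
  let dℝ : C(unitSphere n, ℝ) := ⟨fun σ => d σ, by fun_prop⟩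
  refine ENNReal.le_of_forall_pos_le_add fun ε hε _ => ?_
  obtain ⟨H, hH, hHd⟩ := hℓ.exists_polyOp_eq_zero_near_below dℝ (NNReal.coe_pos.2 hε)
  have hle : w 0 ≤ (M - polyFun H 0 : ℝ) := by
    refine hℓ.le_on_closedBall hw one_ne_zero hX (h := fun y => M - polyFun H y)
      (contDiff_const.sub (contDiff_polyFun H)) (fun x => ?_) (fun y hy => ?_) 0 (by simp)
    · rw [hessian_sub contDiffAt_const (contDiff_polyFun H).contDiffAt, hessian_const, zero_sub,
        map_neg, ← polyFun_polyOp, hH, map_zero, Pi.zero_apply, neg_zero]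
    · rw [← deficit_le_deficit_iff (hM y (Metric.sphere_subset_closedBall hy)), deficit_coe,
        sub_sub_cancel]
      refine le_trans (ENNReal.ofReal_le_ofReal (hHd ⟨y, hy⟩).1) ?_
      simpa [dℝ] using hd ⟨y, hy⟩
  have hint_le : ∫ σ, dℝ σ ∂μ ≤ polyFun H 0 + ε := by
    have hHint : Integrable (fun σ : unitSphere n => polyFun H σ) μ := by
      simpa only [polySphere_apply] using hintegral (polySphere H)
    calc ∫ σ, dℝ σ ∂μ ≤ ∫ σ : unitSphere n, (polyFun H σ + ε) ∂μ :=
          integral_mono (hintegral dℝ) (hHint.add (integrable_const _)) fun σ => (hHd σ).2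
      _ = polyFun H 0 + ε := by
          rw [integral_add hHint (integrable_const _), hμ H hH]
          simp
  calc ∫⁻ σ, d σ ∂μ = ENNReal.ofReal (∫ σ, dℝ σ ∂μ) := lintegral_coe_eq_integral _ (hintegral dℝ)
    _ ≤ ENNReal.ofReal (polyFun H 0) + ε :=
        (ENNReal.ofReal_le_ofReal hint_le).trans
          (ENNReal.ofReal_add_le.trans_eq (by rw [ENNReal.ofReal_coe_nnreal]))
    _ = deficit M (M - polyFun H 0 : ℝ) + ε := by rw [deficit_coe, sub_sub_cancel]
    _ ≤ deficit M (w 0) + ε := by gcongr; exact antitone_deficit M hle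

end HarmonicMeasure

theorem IsSubharmonic.comp_affine {F F' : Set (SymMat n)} {X : Set (Rn n)} {v : Rn n → EReal}
    (hv : IsSubharmonic F X v) {M N : Matrix (Fin n) (Fin n) ℝ} (hMN : M * N = 1) (hNM : N * M = 1)
    (hF : ∀ A ∈ F, ∃ B ∈ F', (B : Matrix (Fin n) (Fin n) ℝ) = M.transpose * A * M) (b : Rn n) :
    IsSubharmonic F' {y | b + Matrix.toEuclideanLin M y ∈ X}
      fun y => v (b + Matrix.toEuclideanLin M y) where
  usc := hv.usc.comp (by fun_prop) fun y hy => hy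
  lt_top y hy := hv.lt_top _ hy
  viscosity y hy φ hφ hle heq := by
    set T : Rn n → Rn n := fun y => b + Matrix.toEuclideanLin M y
    set S : Rn n → Rn n := fun z => Matrix.toEuclideanLin N (z - b)
    have hTS (z : Rn n) : T (S z) = z := by simp [T, S, Matrix.toLpLin_apply, hMN]
    have hST (y : Rn n) : S (T y) = y := by simp [T, S, Matrix.toLpLin_apply, hNM]
    have hS : ContDiff ℝ 2 S :=
      (LinearMap.toContinuousLinearMap (Matrix.toEuclideanLin N)).contDiff.comp
        (contDiff_id.sub contDiff_const)
    have hφS : ContDiffAt ℝ 2 (φ ∘ S) (T y) := ((hST y).symm ▸ hφ).comp _ hS.contDiffAt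
    obtain ⟨A, hA, hAφ⟩ := hv.viscosity (T y) hy (φ ∘ S) hφS
      (by
        have hle' : ∀ᶠ y' in 𝓝 (S (T y)), v (T y') ≤ φ y' := (hST y).symm ▸ hle
        filter_upwards [hS.continuous.continuousAt.eventually hle'] with z hz
        rwa [hTS] at hz)
      (by rw [Function.comp_apply, hST]; exact heq)
    obtain ⟨B, hB, hBA⟩ := hF A hA
    refine ⟨B, hB, ?_⟩
    rw [hBA, hAφ, ← hessian_comp_affine M hφS]
    exact congrArg (hessian · y) (funext fun y' => congrArg φ (hST y'))

theorem continuousAt_apply_hessian (ℓ : Matrix (Fin n) (Fin n) ℝ →ₗ[ℝ] ℝ) {φ : Rn n → ℝ} {x : Rn n}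
    (hφ : ContDiffAt ℝ 2 φ x) : ContinuousAt (fun y => ℓ (hessian φ y)) x := by
  have h : ContinuousAt (fderiv ℝ (fderiv ℝ φ)) x :=
    ((hφ.fderiv_right (m := 1) le_rfl).fderiv_right (m := 0) le_rfl).continuousAt
  refine ℓ.continuous_of_finiteDimensional.continuousAt.comp (continuousAt_pi.2 fun i =>
    continuousAt_pi.2 fun j => ?_)
  exact (h.clm_apply continuousAt_const).clm_apply continuousAt_const

section Submean

variable {ℓ : Matrix (Fin n) (Fin n) ℝ →ₗ[ℝ] ℝ} {μ : Measure (unitSphere n)}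
  [IsProbabilityMeasure μ] {X : Set (Rn n)} {w : Rn n → EReal}

theorem IsHarmonicMeasure.lintegral_deficit_le (hμ : IsHarmonicMeasure ℓ μ) (hℓ : IsElliptic ℓ)
    (hw : IsSubharmonic (halfSpace ℓ) X w) {x : Rn n} {r : ℝ} (hr : 0 < r)
    (hX : Metric.closedBall x r ⊆ X) {M : ℝ} (hM : ∀ y ∈ Metric.closedBall x r, w y ≤ M) :
    ∫⁻ σ : unitSphere n, deficit M (w (x + r • (σ : Rn n))) ∂μ ≤ deficit M (w x) := by
  have hsub := hw.comp_affine (M := r • 1) (N := r⁻¹ • 1) (by simp [hr.ne']) (by simp [hr.ne'])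
    (fun A hA => ⟨(r ^ 2) • A, isCone_halfSpace ℓ _ (by positivity) A hA, by
      simp [smul_smul, sq]⟩) x
  simp only [map_smul, Matrix.toLpLin_one, LinearMap.smul_apply, LinearMap.id_apply] at hsub
  have hball (y : Rn n) (hy : y ∈ Metric.closedBall 0 1) :
      x + r • y ∈ Metric.closedBall x r := by
    rw [mem_closedBall_zero_iff] at hy
    rw [mem_closedBall_iff_norm, add_sub_cancel_left, norm_smul, Real.norm_of_nonneg hr.le]
    exact mul_le_of_le_one_right hr.le hy
  simpa using hμ.lintegral_deficit_le_unit hℓ hsub (fun y hy => hX (hball y hy))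
    fun y hy => hM _ (hball y hy)

theorem IsHarmonicMeasure.exists_lintegral_ofReal_add_sq_le (hμ : IsHarmonicMeasure ℓ μ)
    (hℓ : IsElliptic ℓ) {φ : Rn n → ℝ} {x : Rn n} (hφ : ContDiffAt ℝ 2 φ x)
    (hneg : ℓ (hessian φ x) < 0) :
    ∃ η > (0 : ℝ), ∀ᶠ r in 𝓝[>] (0 : ℝ),
      ∫⁻ σ : unitSphere n,
        ENNReal.ofReal (1 + φ (x + r • (σ : Rn n)) - φ x + η * r ^ 2) ∂μ ≤ 1 := by
  obtain ⟨η, hη, hηneg⟩ : ∃ η > 0, ℓ (hessian φ x) + (2 * η) * ℓ 1 < 0 := by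
    have := hℓ.one_pos
    refine ⟨-ℓ (hessian φ x) / (4 * ℓ 1), div_pos (neg_pos.2 hneg) (by positivity), ?_⟩
    field_simp
    linarith
  refine ⟨η, hη, ?_⟩
  set ψ : Rn n → ℝ := fun y => -φ y + -η * ‖y - x‖ ^ 2
  have hψ (y : Rn n) (hy : ContDiffAt ℝ 2 φ y) : ContDiffAt ℝ 2 ψ y :=
    hy.neg.add (contDiff_mul_norm_sub_sq _ _).contDiffAt
  have hhess (y : Rn n) (hy : ContDiffAt ℝ 2 φ y) :
      ℓ (hessian ψ y) = -(ℓ (hessian φ y) + (2 * η) * ℓ 1) := by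
    rw [hessian_add hy.neg (contDiff_mul_norm_sub_sq _ _).contDiffAt, hessian_neg hy,
      hessian_mul_norm_sub_sq, map_add, map_neg, map_smul, smul_eq_mul]
    ring
  have hev : ∀ᶠ y in 𝓝 x, ContDiffAt ℝ 2 φ y ∧ ℓ (hessian φ y) + (2 * η) * ℓ 1 < 0 ∧
      ψ y < ψ x + 1 :=
    (hφ.eventually (by simp)).and <|
      (((continuousAt_apply_hessian ℓ hφ).add continuousAt_const).eventually_lt_const hηneg).and <|
        (hψ x hφ).continuousAt.eventually_lt_const (lt_add_one _)
  obtain ⟨ρ, hρ, hball⟩ := Metric.eventually_nhds_iff_ball.1 hev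
  have hsub : IsSubharmonic (halfSpace ℓ) (Metric.ball x ρ) fun y => (ψ y : EReal) :=
    hℓ.isSubharmonic_of_contDiffAt (fun y hy => hψ y (hball y hy).1) fun y hy => by
      rw [hhess y (hball y hy).1]
      exact neg_nonneg.2 (hball y hy).2.1.le
  filter_upwards [Ioo_mem_nhdsGT hρ] with r hr
  have hsubset := Metric.closedBall_subset_ball (x := x) hr.2
  have := hμ.lintegral_deficit_le hℓ hsub hr.1 hsubset (M := ψ x + 1) fun y hy =>
    EReal.coe_le_coe_iff.2 (hball y (hsubset hy)).2.2.le
  refine le_trans (lintegral_mono fun σ => ?_) (this.trans_eq ?_)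
  · rw [deficit_coe]
    refine ENNReal.ofReal_le_ofReal (le_of_eq ?_)
    simp [ψ, norm_smul, mem_sphere_zero_iff_norm.1 σ.2]
    ring
  · rw [deficit_coe, add_sub_cancel_left, ENNReal.ofReal_one]

theorem IsHarmonicMeasure.eventually_lt_lintegral_deficit (hμ : IsHarmonicMeasure ℓ μ)
    (hℓ : IsElliptic ℓ) {φ : Rn n → ℝ} {x : Rn n} (hφ : ContDiffAt ℝ 2 φ x)
    (hneg : ℓ (hessian φ x) < 0) {M : ℝ} (hM : φ x ≤ M) :
    ∀ᶠ r in 𝓝[>] (0 : ℝ),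
      deficit M (φ x) < ∫⁻ σ : unitSphere n, deficit M (φ (x + r • (σ : Rn n)) : ℝ) ∂μ := by
  obtain ⟨η, hη, hφμ⟩ := hμ.exists_lintegral_ofReal_add_sq_le hℓ hφ hneg
  obtain ⟨ρ, hρ, hcont⟩ := Metric.eventually_nhds_iff_ball.1 (hφ.eventually (by simp))
  filter_upwards [hφμ, Ioo_mem_nhdsGT hρ] with r hφr hr
  have hφcont : Continuous fun σ : unitSphere n => φ (x + r • (σ : Rn n)) :=
    continuous_iff_continuousAt.2 fun σ => (hcont _ (by
      simpa [norm_smul, mem_sphere_zero_iff_norm.1 σ.2, abs_of_pos hr.1] using hr.2)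
        ).continuousAt.comp (f := fun σ : unitSphere n => x + r • (σ : Rn n)) (by fun_prop)
  have hηr : 0 < η * r ^ 2 := mul_pos hη (pow_pos hr.1 2)
  refine lt_of_add_lt_add_right (a := 1) ?_
  calc deficit M (φ x) + 1 = ENNReal.ofReal (M - φ x + 1) := by
        rw [deficit_coe, ENNReal.ofReal_add (by linarith) zero_le_one, ENNReal.ofReal_one]
    _ < ENNReal.ofReal (M - φ x + 1 + η * r ^ 2) :=
        (ENNReal.ofReal_lt_ofReal_iff (by linarith)).2 (lt_add_of_pos_right _ hηr)
    _ = ∫⁻ _ : unitSphere n, ENNReal.ofReal (M - φ x + 1 + η * r ^ 2) ∂μ := by simp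
    _ ≤ ∫⁻ σ : unitSphere n, (deficit M (φ (x + r • (σ : Rn n)) : ℝ) +
          ENNReal.ofReal (1 + φ (x + r • (σ : Rn n)) - φ x + η * r ^ 2)) ∂μ :=
        lintegral_mono fun σ => by
          rw [deficit_coe]
          exact (ENNReal.ofReal_le_ofReal (le_of_eq (by ring))).trans ENNReal.ofReal_add_le
    _ = ∫⁻ σ : unitSphere n, deficit M (φ (x + r • (σ : Rn n)) : ℝ) ∂μ +
          ∫⁻ σ : unitSphere n, ENNReal.ofReal (1 + φ (x + r • (σ : Rn n)) - φ x + η * r ^ 2) ∂μ :=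
        lintegral_add_left ((continuous_deficit M).comp
          (continuous_coe_real_ereal.comp hφcont)).measurable _
    _ ≤ ∫⁻ σ : unitSphere n, deficit M (φ (x + r • (σ : Rn n)) : ℝ) ∂μ + 1 := by gcongr

theorem IsHarmonicMeasure.isSubharmonic_of_lintegral_deficit_le (hμ : IsHarmonicMeasure ℓ μ)
    (hℓ : IsElliptic ℓ) (husc : UpperSemicontinuousOn w X) (hlt : ∀ x ∈ X, w x < ⊤)
    (h : ∀ x ∈ X, ∃ M : ℝ, w x ≤ M ∧ ∀ᶠ r in 𝓝[>] (0 : ℝ),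
      ∫⁻ σ : unitSphere n, deficit M (w (x + r • (σ : Rn n))) ∂μ ≤ deficit M (w x)) :
    IsSubharmonic (halfSpace ℓ) X w where
  usc := husc
  lt_top := hlt
  viscosity x hx φ hφ hle heq := by
    refine exists_mem_halfSpace_eq_hessian hφ ?_
    by_contra! hneg
    obtain ⟨M, hM, hw⟩ := h x hx
    obtain ⟨ρ, hρ, hball⟩ := Metric.eventually_nhds_iff_ball.1 hle
    obtain ⟨r, hwr, hφr, hr⟩ := (hw.and ((hμ.eventually_lt_lintegral_deficit hℓ hφ hneg
      (EReal.coe_le_coe_iff.1 (heq ▸ hM))).and (Ioo_mem_nhdsGT hρ))).exists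
    refine hφr.not_ge ((lintegral_mono fun σ => antitone_deficit M (hball _ ?_)).trans
      (hwr.trans_eq (by rw [heq])))
    simpa [norm_smul, mem_sphere_zero_iff_norm.1 σ.2, abs_of_pos hr.1] using hr.2

end Submean

/-! ### Averaging over a transitive group -/

section Averaging

variable {Γ S : Type*} [Group Γ] [MeasurableSpace Γ] [MeasurableSpace S] [MulAction Γ S]
  [MulAction.IsPretransitive Γ S] [MeasurableSMul₂ Γ S] [MeasurableMul Γ]

theorem lintegral_smul_eq_lintegral (η : Measure Γ) [IsProbabilityMeasure η]
    [η.IsMulRightInvariant] (μ : Measure S) [IsProbabilityMeasure μ] [SMulInvariantMeasure Γ S μ]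
    {f : S → ENNReal} (hf : Measurable f) (s : S) :
    ∫⁻ g, f (g • s) ∂η = ∫⁻ t, f t ∂μ := by
  have hη (t : S) : ∫⁻ g : Γ, f (g • t) ∂η = ∫⁻ g : Γ, f (g • s) ∂η := by
    obtain ⟨h, rfl⟩ := MulAction.exists_smul_eq Γ s t
    simpa only [mul_smul] using lintegral_mul_right_eq_self (μ := η) (fun g => f (g • s)) h
  calc ∫⁻ g, f (g • s) ∂η = ∫⁻ t, ∫⁻ g : Γ, f (g • t) ∂η ∂μ := by simp [hη]
    _ = ∫⁻ g : Γ, ∫⁻ t, f (g • t) ∂μ ∂η :=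
        lintegral_lintegral_swap (hf.comp (measurable_snd.smul measurable_fst)).aemeasurable
    _ = ∫⁻ _ : Γ, ∫⁻ t, f t ∂μ ∂η :=
        lintegral_congr fun g => (measurePreserving_smul g μ).lintegral_comp hf
    _ = ∫⁻ t, f t ∂μ := by simp

end Averaging

/-- The linear isometry of `ℝⁿ` given by an orthogonal matrix. -/
def isometry : Matrix.orthogonalGroup (Fin n) ℝ →* (Rn n ≃ₗᵢ[ℝ] Rn n) :=
  Unitary.linearIsometryEquiv.toMonoidHom.comp
    (Unitary.map
      { toFun := Matrix.toEuclideanCLM (n := Fin n) (𝕜 := ℝ)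
        map_one' := map_one (Matrix.toEuclideanCLM (n := Fin n) (𝕜 := ℝ))
        map_mul' := map_mul (Matrix.toEuclideanCLM (n := Fin n) (𝕜 := ℝ))
        map_star' := map_star (Matrix.toEuclideanCLM (n := Fin n) (𝕜 := ℝ)) }).toMonoidHom

theorem isometry_apply (g : Matrix.orthogonalGroup (Fin n) ℝ) (x : Rn n) :
    isometry g x = Matrix.toEuclideanLin (g : Matrix (Fin n) (Fin n) ℝ) x := rfl

instance : MulAction (Matrix.orthogonalGroup (Fin n) ℝ) (unitSphere n) where
  smul g σ := ⟨isometry g σ, by simp⟩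
  one_smul σ := Subtype.ext (by change isometry 1 (σ : Rn n) = σ; simp)
  mul_smul g h σ := Subtype.ext (by change isometry (g * h) (σ : Rn n) = _; rw [map_mul]; rfl)

theorem coe_smul (g : Matrix.orthogonalGroup (Fin n) ℝ) (σ : unitSphere n) :
    ((g • σ : unitSphere n) : Rn n) = isometry g σ := rfl

instance : ContinuousSMul (Matrix.orthogonalGroup (Fin n) ℝ) (unitSphere n) := by
  refine ⟨Continuous.subtype_mk ?_ _⟩
  simp only [isometry_apply, Matrix.toLpLin_apply]
  fun_prop

instance : MeasurableSpace (Matrix.orthogonalGroup (Fin n) ℝ) := borel _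

instance : BorelSpace (Matrix.orthogonalGroup (Fin n) ℝ) := ⟨rfl⟩

instance : CompactSpace (Matrix.orthogonalGroup (Fin n) ℝ) := by
  refine isCompact_iff_compactSpace.1 <| IsCompact.of_isClosed_subset
    (isCompact_univ_pi fun _ : Fin n => isCompact_univ_pi fun _ : Fin n =>
      isCompact_Icc (a := (-1 : ℝ)) (b := 1))
    isClosed_unitary fun A hA i _ j _ => abs_le.1 (entry_norm_bound_of_unitary hA i j)

open scoped Pointwise in
instance : SMulInvariantMeasure (Matrix.orthogonalGroup (Fin n) ℝ) (unitSphere n)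
    (sphereMeasure n) where
  measure_preimage_smul g s hs := by
    have hcone : isometry g ⁻¹' (Set.Ioo (0 : ℝ) 1 • ((↑) '' s)) =
        Set.Ioo (0 : ℝ) 1 • ((↑) '' ((g • ·) ⁻¹' s : Set (unitSphere n)) : Set (Rn n)) := by
      ext x
      simp only [Set.mem_smul, Set.mem_image, Set.mem_preimage]
      constructor
      · rintro ⟨r, hr, _, ⟨σ, hσ, rfl⟩, h⟩
        refine ⟨r, hr, _, ⟨g⁻¹ • σ, by rwa [smul_inv_smul], rfl⟩, (isometry g).injective ?_⟩
        rw [map_smul, ← coe_smul, smul_inv_smul, h]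
      · rintro ⟨r, hr, _, ⟨σ, hσ, rfl⟩, rfl⟩
        exact ⟨r, hr, _, ⟨g • σ, hσ, rfl⟩, (map_smul _ _ _).symm⟩
    simp only [sphereMeasure, Measure.smul_apply,
      Measure.toSphere_apply' _ ((measurable_const_smul g) hs), Measure.toSphere_apply' _ hs]
    rw [← hcone, (isometry g).measurePreserving.measure_preimage_emb
      (isometry g).toHomeomorph.measurableEmbedding]

instance [Nonempty (unitSphere n)] : IsProbabilityMeasure (sphereMeasure n) := by
  obtain ⟨σ⟩ := ‹Nonempty (unitSphere n)›
  have : Nontrivial (Rn n) := ⟨σ, 0, ne_zero_of_mem_unit_sphere σ⟩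
  refine ⟨ENNReal.inv_mul_cancel ?_ (measure_ne_top _ _)⟩
  rw [Ne, Measure.measure_univ_eq_zero]
  exact Measure.toSphere_ne_zero _

theorem exists_eq_norm_smul [Nonempty (unitSphere n)] (x : Rn n) :
    ∃ σ : unitSphere n, x = ‖x‖ • (σ : Rn n) := by
  obtain rfl | hx := eq_or_ne x 0
  · exact ⟨Classical.arbitrary _, by simp⟩
  · exact ⟨⟨‖x‖⁻¹ • x, by simp [norm_smul, hx]⟩, by simp [smul_smul, hx]⟩

theorem lintegral_isometry_eq_lintegral_sphere [Nonempty (unitSphere n)]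
    (Γ : Subgroup (Matrix.orthogonalGroup (Fin n) ℝ)) [MulAction.IsPretransitive Γ (unitSphere n)]
    (η : Measure Γ) [IsProbabilityMeasure η] [η.IsMulRightInvariant] {D : Rn n → ENNReal}
    (hD : Measurable D) (x : Rn n) :
    ∫⁻ g : Γ, D (isometry (g : Matrix.orthogonalGroup (Fin n) ℝ) x) ∂η =
      ∫⁻ σ : unitSphere n, D (‖x‖ • (σ : Rn n)) ∂sphereMeasure n := by
  obtain ⟨σ, hσ⟩ := exists_eq_norm_smul x
  rw [← lintegral_smul_eq_lintegral η (sphereMeasure n) (by fun_prop) σ]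
  refine lintegral_congr fun g => ?_
  conv_lhs => rw [hσ, map_smul]
  rfl

theorem IsSTInvariant.exists_isClosed_subgroup {F : Set (SymMat n)} (hF : IsClosed F)
    (h : IsSTInvariant F) :
    ∃ Γ : Subgroup (Matrix.orthogonalGroup (Fin n) ℝ),
      IsClosed (Γ : Set (Matrix.orthogonalGroup (Fin n) ℝ)) ∧
      MulAction.IsPretransitive Γ (unitSphere n) ∧ ∀ g ∈ Γ, ∀ A ∈ F, conj g A ∈ F := by
  obtain ⟨G, htrans, hG⟩ := h
  refine ⟨G.topologicalClosure, G.isClosed_topologicalClosure, ⟨fun σ τ => ?_⟩, fun g hg A hA => ?_⟩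
  · obtain ⟨g, hg, hgσ⟩ := htrans σ τ (by simp) (by simp)
    exact ⟨⟨g, G.le_topologicalClosure hg⟩, Subtype.ext hgσ⟩
  · have hconj : Continuous fun g : Matrix.orthogonalGroup (Fin n) ℝ => conj g A :=
      Continuous.subtype_mk (by fun_prop) _
    exact closure_minimal (fun g hg => hG g hg A hA) (hF.preimage hconj) hg

theorem IsSTInvariant.exists_averaging_measure [Nonempty (unitSphere n)] {F : Set (SymMat n)}
    (hF : IsClosed F) (h : IsSTInvariant F) :
    ∃ (Γ : Subgroup (Matrix.orthogonalGroup (Fin n) ℝ)) (η : Measure Γ),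
      IsProbabilityMeasure η ∧ (∀ g ∈ Γ, ∀ A ∈ F, conj g A ∈ F) ∧
      ∀ D : Rn n → ENNReal, Measurable D → ∀ x,
        ∫⁻ g : Γ, D (isometry (g : Matrix.orthogonalGroup (Fin n) ℝ) x) ∂η =
          ∫⁻ σ : unitSphere n, D (‖x‖ • (σ : Rn n)) ∂sphereMeasure n := by
  obtain ⟨Γ, hΓ, htrans, hinv⟩ := h.exists_isClosed_subgroup hF
  have : CompactSpace Γ := isCompact_iff_compactSpace.1 hΓ.isCompact
  let K : TopologicalSpace.PositiveCompacts Γ := ⟨⟨Set.univ, isCompact_univ⟩, by simp⟩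
  have : IsProbabilityMeasure (Measure.haarMeasure K) := ⟨Measure.haarMeasure_self⟩
  have : IsProbabilityMeasure (Measure.haarMeasure K).inv :=
    Measure.isProbabilityMeasure_map measurable_inv.aemeasurable
  exact ⟨Γ, _, this, hinv, fun D hD x => lintegral_isometry_eq_lintegral_sphere Γ _ hD x⟩

theorem IsSubharmonic.comp_isometry {F : Set (SymMat n)} {g : Matrix.orthogonalGroup (Fin n) ℝ}
    (hg : ∀ A ∈ F, conj g⁻¹ A ∈ F) {X : Set (Rn n)} {v : Rn n → EReal}
    (hv : IsSubharmonic F X v) (b : Rn n) :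
    IsSubharmonic F {x | b + isometry g x ∈ X} fun x => v (b + isometry g x) :=
  hv.comp_affine (Matrix.mem_unitaryGroup_iff.1 g.2)
    (Matrix.UnitaryGroup.star_mul_self g) (fun A hA => ⟨conj g⁻¹ A, hg A hA, by
      simp [conj, Matrix.star_eq_conjTranspose, Matrix.conjTranspose_eq_transpose_of_trivial]⟩) b

/-! ### The Riesz characteristic -/

theorem posSemidef_smul_one_add (A : SymMat n) {t : ℝ}
    (ht : ‖Matrix.toEuclideanCLM (𝕜 := ℝ) (A : Matrix (Fin n) (Fin n) ℝ)‖ ≤ t) :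
    ((t • 1 + A : SymMat n) : Matrix (Fin n) (Fin n) ℝ).PosSemidef := by
  refine Matrix.PosSemidef.of_dotProduct_mulVec_nonneg (t • 1 + A : SymMat n).2 fun x => ?_
  set T := Matrix.toEuclideanCLM (𝕜 := ℝ) (A : Matrix (Fin n) (Fin n) ℝ)
  set y : Rn n := WithLp.toLp 2 x
  have hnorm : |inner ℝ y (T y)| ≤ t * ‖y‖ ^ 2 :=
    calc |inner ℝ y (T y)| ≤ ‖y‖ * (‖T‖ * ‖y‖) :=
          (abs_real_inner_le_norm _ _).trans (by gcongr; exact T.le_opNorm y)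
      _ = ‖T‖ * ‖y‖ ^ 2 := by ring
      _ ≤ t * ‖y‖ ^ 2 := by gcongr
  have hdot : x ⬝ᵥ x = ‖y‖ ^ 2 := by
    rw [EuclideanSpace.real_norm_sq_eq]
    simp only [dotProduct, y, sq]
  have hexpand : star x ⬝ᵥ ((t • 1 + A : SymMat n) : Matrix (Fin n) (Fin n) ℝ).mulVec x =
      t * ‖y‖ ^ 2 + inner ℝ y (T y) := by
    rw [Matrix.inner_toEuclideanCLM]
    simp [y, Matrix.add_mulVec, Matrix.smul_mulVec, hdot]
  linarith [neg_le_of_abs_le hnorm]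

theorem IsSubequation.add_smul_one_mem_interior {F : Set (SymMat n)} (hF : IsSubequation F)
    {A : SymMat n} (hA : A ∈ F) {ε : ℝ} (hε : 0 < ε) : A + ε • (1 : SymMat n) ∈ interior F := by
  let N : SymMat n → ℝ := fun B => ‖Matrix.toEuclideanCLM (𝕜 := ℝ)
    ((B - (A + ε • (1 : SymMat n)) : SymMat n) : Matrix (Fin n) (Fin n) ℝ)‖
  have hN : Continuous N :=
    ((Matrix.toEuclideanCLM (n := Fin n) (𝕜 := ℝ)).toAlgEquiv.toLinearMap
      |>.continuous_of_finiteDimensional.comp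
        (continuous_subtype_val.comp (continuous_id.sub continuous_const))).norm
  refine mem_interior.2 ⟨{B | N B < ε}, fun B hB => ?_, isOpen_lt hN continuous_const,
    by simpa [N] using hε⟩
  have hPSD := posSemidef_smul_one_add (B - (A + ε • (1 : SymMat n))) (le_of_lt hB)
  convert hF.positivity A hA (ε • (1 : SymMat n) + (B - (A + ε • (1 : SymMat n))))
    hPSD using 1
  abel

theorem IsCone.zero_mem {F : Set (SymMat n)} (hcone : IsCone F) (hne : F.Nonempty) :
    (0 : SymMat n) ∈ F := by
  obtain ⟨A, hA⟩ := hne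
  simpa using hcone 0 le_rfl A hA

theorem IsSubequation.mem_of_posSemidef {F : Set (SymMat n)} (hF : IsSubequation F)
    (hcone : IsCone F) (hne : F.Nonempty) {P : SymMat n}
    (hP : (P : Matrix (Fin n) (Fin n) ℝ).PosSemidef) : P ∈ F := by
  simpa using hF.positivity 0 (hcone.zero_mem hne) P hP

theorem IsSubequation.eq_univ_of_neg_one_mem {F : Set (SymMat n)} (hF : IsSubequation F)
    (hcone : IsCone F) (h : -1 ∈ F) : F = Set.univ :=
  Set.eq_univ_of_forall fun A => by
    let T := Matrix.toEuclideanCLM (𝕜 := ℝ) (A : Matrix (Fin n) (Fin n) ℝ)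
    simpa [T] using hF.positivity _ (hcone _ (norm_nonneg T) _ h) _
      (posSemidef_smul_one_add A le_rfl)

theorem exists_clm_nonneg_on_cone {E : Type*} [AddCommGroup E] [Module ℝ E] [TopologicalSpace E]
    [IsTopologicalAddGroup E] [ContinuousSMul ℝ E] {K : Set E} (hconv : Convex ℝ K)
    (hcone : ∀ t : ℝ, 0 ≤ t → ∀ a ∈ K, t • a ∈ K) (hne : (interior K).Nonempty) {x : E}
    (hx : x ∉ interior K) : ∃ f : E →L[ℝ] ℝ, f ≠ 0 ∧ (∀ a ∈ K, 0 ≤ f a) ∧ f x ≤ 0 := by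
  obtain ⟨f, hf⟩ := geometric_hahn_banach_open_point hconv.interior isOpen_interior hx
  have hle (a : E) (ha : a ∈ K) : f a ≤ f x :=
    closure_minimal (fun b hb => (hf b hb).le) (isClosed_le f.continuous continuous_const)
      ((hconv.closure_interior_eq_closure_of_nonempty_interior hne).ge (subset_closure ha))
  obtain ⟨b, hb⟩ := hne
  refine ⟨-f, fun h => ?_, fun a ha => ?_, ?_⟩
  · simpa [neg_eq_zero.1 h] using hf b hb
  · by_contra! hneg
    have hpos : 0 < f a := by simpa using hneg
    obtain ⟨t, ht⟩ := exists_nat_gt (f x / f a)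
    have := hle _ (hcone t t.cast_nonneg a ha)
    rw [map_smul, smul_eq_mul] at this
    exact this.not_gt ((div_lt_iff₀ hpos).1 ht)
  · simpa using hle _ (hcone 0 le_rfl b (interior_subset hb))

instance : ContinuousSMul ℝ (SymMat n) :=
  ⟨Continuous.subtype_mk (continuous_fst.smul (continuous_subtype_val.comp continuous_snd)) _⟩

theorem exists_isElliptic_subset_halfSpace {F : Set (SymMat n)} (hF : IsSubequation F)
    (hcone : IsCone F) (hconv : Convex ℝ F) (hne : F.Nonempty) {E : SymMat n}
    (hE : E ∉ interior F) :
    ∃ ℓ : Matrix (Fin n) (Fin n) ℝ →ₗ[ℝ] ℝ, IsElliptic ℓ ∧ F ⊆ halfSpace ℓ ∧ ℓ E ≤ 0 := by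
  obtain ⟨f, hf, hfF, hfE⟩ := exists_clm_nonneg_on_cone hconv hcone
    ⟨_, hF.add_smul_one_mem_interior (hcone.zero_mem hne) one_pos⟩ hE
  let ℓ : Matrix (Fin n) (Fin n) ℝ →ₗ[ℝ] ℝ := f.toLinearMap ∘ₗ selfAdjointPart ℝ
  have hℓ (A : SymMat n) : ℓ A = f A :=
    congrArg f (Subtype.ext (IsSelfAdjoint.coe_selfAdjointPart_apply ℝ A.2))
  have hPSD (P : SymMat n) (hP : (P : Matrix (Fin n) (Fin n) ℝ).PosSemidef) : 0 ≤ f P :=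
    hfF P (hF.mem_of_posSemidef hcone hne hP)
  have hone : 0 < f 1 := by
    refine (hPSD 1 (by simpa using Matrix.PosSemidef.one)).lt_of_ne' fun h0 => hf ?_
    have hnonneg (A : SymMat n) : 0 ≤ f A := by
      simpa [h0] using hPSD _ (posSemidef_smul_one_add A le_rfl)
    ext A
    exact le_antisymm (by simpa using hnonneg (-A)) (hnonneg A)
  refine ⟨ℓ, ⟨fun P hP => ?_, (hℓ 1).symm ▸ hone⟩, fun A hA => ?_, (hℓ E).trans_le hfE⟩
  · exact (hPSD ⟨P, hP.isHermitian⟩ hP).trans_eq (hℓ ⟨P, hP.isHermitian⟩).symm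
  · exact (hfF A hA).trans_eq (hℓ A).symm

theorem mem_of_forall_isElliptic {F : Set (SymMat n)} (hF : IsSubequation F)
    (hcone : IsCone F) (hconv : Convex ℝ F) (hne : F.Nonempty) {A : SymMat n}
    (hA : ∀ ℓ, IsElliptic ℓ → F ⊆ halfSpace ℓ → A ∈ halfSpace ℓ) : A ∈ F := by
  by_contra hAF
  have hlim : Filter.Tendsto (fun ε : ℝ => A + ε • (1 : SymMat n)) (𝓝[>] 0) (𝓝 A) := by
    refine (Continuous.tendsto' ?_ 0 A (by simp)).mono_left nhdsWithin_le_nhds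
    fun_prop
  obtain ⟨ε, hεF, hε : 0 < ε⟩ :=
    ((hlim.eventually (hF.isClosed.isOpen_compl.mem_nhds hAF)).and self_mem_nhdsWithin).exists
  obtain ⟨ℓ, hℓ, hsub, hle⟩ := exists_isElliptic_subset_halfSpace hF hcone hconv hne
    (fun h => hεF (interior_subset h))
  have hpos : 0 < ε * ℓ 1 := mul_pos hε hℓ.one_pos
  have hAℓ : 0 ≤ ℓ A := hA ℓ hℓ hsub
  have : ℓ A + ε * ℓ 1 ≤ 0 := by simpa using hle
  linarith

theorem isSubharmonic_of_forall_isElliptic {F : Set (SymMat n)} (hF : IsSubequation F)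
    (hcone : IsCone F) (hconv : Convex ℝ F) (hne : F.Nonempty) {X : Set (Rn n)}
    {u : Rn n → EReal} (husc : UpperSemicontinuousOn u X) (hlt : ∀ x ∈ X, u x < ⊤)
    (hu : ∀ ℓ, IsElliptic ℓ → F ⊆ halfSpace ℓ → IsSubharmonic (halfSpace ℓ) X u) :
    IsSubharmonic F X u where
  usc := husc
  lt_top := hlt
  viscosity x hx φ hφ hle heq := by
    refine ⟨⟨hessian φ x, hessian_isSelfAdjoint hφ⟩, ?_, rfl⟩
    refine mem_of_forall_isElliptic hF hcone hconv hne fun ℓ hℓ hsub => ?_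
    obtain ⟨B, hB, hBφ⟩ := (hu ℓ hℓ hsub).viscosity x hx φ hφ hle heq
    exact hB.trans_eq (congrArg ℓ hBφ)

/-- The matrix `I - p e eᵀ`, whose membership in `F` for a unit vector `e` defines the Riesz
characteristic of `F`. -/
def rieszMat (p : ℝ) (e : Rn n) : SymMat n :=
  ⟨1 - p • Matrix.vecMulVec e e, by
    refine (IsSelfAdjoint.one _).sub ?_
    ext i j
    simp [Matrix.vecMulVec_apply, mul_comm]⟩

theorem conj_rieszMat (g : Matrix.orthogonalGroup (Fin n) ℝ) (p : ℝ) (e : Rn n) :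
    conj g (rieszMat p e) = rieszMat p (isometry g e) := by
  apply Subtype.ext
  simp only [conj, rieszMat, mul_sub, sub_mul, mul_one, Matrix.mem_unitaryGroup_iff.1 g.2]
  simp only [Matrix.mul_smul, Matrix.smul_mul, Matrix.mul_vecMulVec, Matrix.vecMulVec_mul,
    isometry_apply, Matrix.toLpLin_apply, Matrix.star_eq_conjTranspose,
    Matrix.conjTranspose_eq_transpose_of_trivial, Matrix.vecMul_transpose]

theorem IsSTInvariant.rieszMat_mem_iff {F : Set (SymMat n)} (h : IsSTInvariant F) (p : ℝ)
    (e e' : unitSphere n) : rieszMat p e ∈ F ↔ rieszMat p e' ∈ F := by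
  obtain ⟨G, htrans, hG⟩ := h
  suffices ∀ e e' : unitSphere n, rieszMat p e ∈ F → rieszMat p e' ∈ F from ⟨this _ _, this _ _⟩
  intro e e' he
  obtain ⟨g, hg, hge⟩ := htrans e e' (by simp) (by simp)
  rw [← hge, ← isometry_apply, ← conj_rieszMat]
  exact hG g hg _ he

theorem exists_rieszMat_notMem {F : Set (SymMat n)} (hF : IsSubequation F) (hcone : IsCone F)
    (hconv : Convex ℝ F) (huniv : F ≠ Set.univ) (hn : n ≠ 0) :
    ∃ (p : ℝ) (e : unitSphere n), rieszMat p e ∉ F := by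
  by_contra! h
  refine huniv (hF.eq_univ_of_neg_one_mem hcone ?_)
  have hn' : (n : ℝ) ≠ 0 := Nat.cast_ne_zero.2 hn
  have hsum := hconv.sum_mem (t := Finset.univ) (w := fun _ : Fin n => (n : ℝ)⁻¹)
    (fun _ _ => by positivity) (by simp [hn'])
    (fun i _ => h (2 * n) ⟨EuclideanSpace.single i 1, by simp⟩)
  have hid : ∑ i : Fin n, Matrix.vecMulVec (EuclideanSpace.single i (1 : ℝ)).ofLp
      (EuclideanSpace.single i (1 : ℝ)).ofLp = 1 := by
    ext a b
    simp [Matrix.sum_apply, Matrix.vecMulVec_apply, Matrix.one_apply, Pi.single_apply]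
  convert hsum using 1
  apply Subtype.ext
  rw [← Finset.smul_sum, selfAdjoint.val_smul, AddSubgroup.val_finsetSum]
  simp only [rieszMat, Finset.sum_sub_distrib, ← Finset.smul_sum, hid]
  simp [smul_sub, smul_smul, ← Nat.cast_smul_eq_nsmul ℝ, hn', mul_comm (2 : ℝ)]
  module

theorem exists_rieszCharacteristic [Nonempty (unitSphere n)] {F : Set (SymMat n)}
    (hF : IsSubequation F) (hcone : IsCone F) (hconv : Convex ℝ F) (hST : IsSTInvariant F)
    (hne : F.Nonempty) (huniv : F ≠ Set.univ) :
    ∃ p : ℝ, ∀ e : unitSphere n, rieszMat p e ∈ frontier F := by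
  have hcont (e : Rn n) : Continuous fun p : ℝ => rieszMat p e :=
    Continuous.subtype_mk (by fun_prop) _
  let e₀ : unitSphere n := Classical.arbitrary _
  have hn : n ≠ 0 := by
    rintro rfl
    exact ne_zero_of_mem_unit_sphere e₀ (Subsingleton.elim _ _)
  obtain ⟨q, e, hq⟩ := exists_rieszMat_notMem hF hcone hconv huniv hn
  obtain ⟨p, hp⟩ : (frontier {p : ℝ | rieszMat p e₀ ∈ F}).Nonempty := by
    refine nonempty_frontier_iff.2 ⟨⟨0, hF.mem_of_posSemidef hcone hne ?_⟩, fun h => hq ?_⟩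
    · simpa [rieszMat] using Matrix.PosSemidef.one
    · exact (hST.rieszMat_mem_iff q e₀ e).1 (h.ge (Set.mem_univ q))
  refine ⟨p, fun e => (hcont e).frontier_preimage_subset F ?_⟩
  simpa only [Set.preimage, hST.rieszMat_mem_iff _ e₀ e] using hp

/-! ### Spherical averages -/

theorem deficit_coe_sub (M : ℝ) (D : ENNReal) : deficit M ((M : EReal) - D) = D := by
  induction D using ENNReal.recTopCoe with
  | top => simp [deficit]
  | coe d =>
    change deficit M ((M : EReal) - ((d : ℝ) : EReal)) = d
    rw [← EReal.coe_sub, deficit_coe, sub_sub_cancel, ENNReal.ofReal_coe_nnreal]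

theorem toENNReal_add_deficit {M : ℝ} {e : EReal} (he : e ≤ M) :
    e.toENNReal + deficit M e + ENNReal.ofReal (-M) = ENNReal.ofReal M + (-e).toENNReal := by
  induction e using EReal.rec with
  | bot => simp [deficit]
  | top => simp at he
  | coe x =>
    have hx : x ≤ M := EReal.coe_le_coe_iff.1 he
    rw [deficit_coe, ← EReal.coe_neg]
    simp only [EReal.toENNReal_of_ne_top (EReal.coe_ne_top _), EReal.toReal_coe, ENNReal.ofReal]
    norm_cast
    refine NNReal.eq ?_
    push_cast [Real.coe_toNNReal']
    grind

theorem coe_sub_coe_eq {M : ℝ} {P Q D : ENNReal} (hP : P ≠ ⊤)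
    (h : P + D + ENNReal.ofReal (-M) = ENNReal.ofReal M + Q) : (P : EReal) - Q = M - D := by
  lift P to NNReal using hP
  obtain rfl | hQ := eq_or_ne Q ⊤
  · obtain rfl : D = ⊤ := by simpa using h
    simp
  have hD : D ≠ ⊤ := by
    rintro rfl
    exact hQ (by simpa using h.symm)
  lift Q to NNReal using hQ
  lift D to NNReal using hD
  have hreal : (P : ℝ) + D + max (-M) 0 = max M 0 + Q := by
    simpa only [Real.coe_toNNReal'] using! congrArg ENNReal.toReal h
  change ((P : ℝ) : EReal) - ((Q : ℝ) : EReal) = (M : EReal) - ((D : ℝ) : EReal)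
  rw [← EReal.coe_sub, ← EReal.coe_sub]
  exact congrArg _ (by grind)

theorem sphericalAverage_eq [Nonempty (unitSphere n)] {u : Rn n → EReal} (hu : Measurable u)
    {M t : ℝ} (hM : ∀ σ : unitSphere n, u (t • (σ : Rn n)) ≤ M) :
    sphericalAverage u t =
      (M : EReal) - ∫⁻ σ : unitSphere n, deficit M (u (t • (σ : Rn n))) ∂sphereMeasure n := by
  have hut : Measurable fun σ : unitSphere n => u (t • (σ : Rn n)) := hu.comp (by fun_prop)
  have hpos : Measurable fun σ : unitSphere n => (u (t • (σ : Rn n))).toENNReal :=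
    EReal.continuous_toENNReal.measurable.comp hut
  refine coe_sub_coe_eq (ne_top_of_le_ne_top ENNReal.ofReal_ne_top (b := ENNReal.ofReal M) ?_) ?_
  · calc ∫⁻ σ : unitSphere n, (u (t • (σ : Rn n))).toENNReal ∂sphereMeasure n
        ≤ ∫⁻ _ : unitSphere n, ENNReal.ofReal M ∂sphereMeasure n :=
          lintegral_mono fun σ => (EReal.toENNReal_le_toENNReal (hM σ)).trans_eq (by
            rw [EReal.toENNReal_of_ne_top (EReal.coe_ne_top _), EReal.toReal_coe])
      _ = ENNReal.ofReal M := by simp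
  · have h := lintegral_congr (μ := sphereMeasure n) fun σ => toENNReal_add_deficit (hM σ)
    rwa [lintegral_add_right _ measurable_const, lintegral_add_left hpos,
      lintegral_add_left measurable_const, lintegral_const, lintegral_const, measure_univ,
      mul_one, mul_one] at h

theorem sphericalAverage_le [Nonempty (unitSphere n)] {u : Rn n → EReal} (hu : Measurable u)
    {M t : ℝ} (hM : ∀ σ : unitSphere n, u (t • (σ : Rn n)) ≤ M) : sphericalAverage u t ≤ M := by
  rw [sphericalAverage_eq hu hM]
  exact (EReal.sub_le_sub le_rfl (EReal.coe_ennreal_nonneg _)).trans_eq (sub_zero _)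

theorem deficit_sphericalAverage [Nonempty (unitSphere n)] {u : Rn n → EReal} (hu : Measurable u)
    {M t : ℝ} (hM : ∀ σ : unitSphere n, u (t • (σ : Rn n)) ≤ M) :
    deficit M (sphericalAverage u t) =
      ∫⁻ σ : unitSphere n, deficit M (u (t • (σ : Rn n))) ∂sphereMeasure n := by
  rw [sphericalAverage_eq hu hM, deficit_coe_sub]

theorem upperSemicontinuousAt_of_deficit {α : Type*} [TopologicalSpace α] {f : α → EReal} {x : α}
    {M : ℝ} (hM : ∀ᶠ y in 𝓝 x, f y ≤ M)
    (h : LowerSemicontinuousAt (fun y => deficit M (f y)) x) : UpperSemicontinuousAt f x := by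
  intro c hc
  obtain hMc | hcM := lt_or_ge (M : EReal) c
  · filter_upwards [hM] with y hy using hy.trans_lt hMc
  · have hlt : deficit M c < deficit M (f x) := by
      rwa [lt_iff_not_ge, deficit_le_deficit_iff hcM, not_le]
    filter_upwards [h _ hlt] with y hy
    exact lt_of_not_ge fun hcy => hy.not_ge (antitone_deficit M hcy)

theorem norm_smul_unitSphere (t : ℝ) (σ : unitSphere n) : ‖t • (σ : Rn n)‖ = |t| := by
  simp [norm_smul]

theorem isOpen_annulus (n : ℕ) (a : ℝ) (b : EReal) : IsOpen (annulus n a b) :=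
  (isOpen_lt continuous_const continuous_norm).inter
    (isOpen_lt (continuous_coe_real_ereal.comp continuous_norm) continuous_const)

theorem isCompact_norm_preimage {E : Type*} [SeminormedAddCommGroup E] [ProperSpace E] {K : Set ℝ}
    (hK : IsCompact K) : IsCompact (norm ⁻¹' K : Set E) := by
  obtain ⟨R, hR⟩ := hK.isBounded.bddAbove
  exact (isCompact_closedBall (0 : E) R).of_isClosed_subset
    (hK.isClosed.preimage continuous_norm) fun x hx => mem_closedBall_zero_iff.2 (hR hx)

theorem exists_real_le_of_upperSemicontinuousOn {α : Type*} [TopologicalSpace α] {K : Set α}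
    (hK : IsCompact K) {u : α → EReal} (hu : UpperSemicontinuousOn u K) (hlt : ∀ y ∈ K, u y < ⊤) :
    ∃ M : ℝ, ∀ y ∈ K, u y ≤ M := by
  obtain rfl | hne := K.eq_empty_or_nonempty
  · exact ⟨0, by simp⟩
  obtain ⟨z, hz, hmax⟩ := hu.exists_isMaxOn hne hK
  obtain ⟨M, hM, -⟩ := EReal.lt_iff_exists_real_btwn.1 (hlt z hz)
  exact ⟨M, fun y hy => (hmax hy).trans hM.le⟩

theorem exists_measurable_eqOn_of_upperSemicontinuousOn {α : Type*} [TopologicalSpace α]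
    [MeasurableSpace α] [BorelSpace α] {X : Set α} (hX : IsOpen X) {u : α → EReal}
    (hu : UpperSemicontinuousOn u X) : ∃ u' : α → EReal, Measurable u' ∧ Set.EqOn u' u X := by
  classical
  refine ⟨X.piecewise u fun _ => ⊥, ?_, Set.piecewise_eqOn X _ _⟩
  refine measurable_of_restrict_of_restrict_compl hX.measurableSet ?_ ?_
  · rw [Set.domRestrict_piecewise]
    exact (upperSemicontinuousOn_iff_restrict.2 hu).measurable
  · rw [Set.domRestrict_piecewise_compl]
    exact measurable_const

section Annulus

variable {a : ℝ} {b : EReal} {v w : Rn n → EReal}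

theorem exists_norm_sub_norm_le_subset_annulus {x : Rn n} (hx : x ∈ annulus n a b) :
    ∃ ε > 0, ∀ y : Rn n, |‖y‖ - ‖x‖| ≤ ε → y ∈ annulus n a b := by
  have hopen : IsOpen {t : ℝ | a < t ∧ (t : EReal) < b} :=
    (isOpen_lt continuous_const continuous_id).inter
      (isOpen_lt continuous_coe_real_ereal continuous_const)
  obtain ⟨ε, hε, hsub⟩ := Metric.nhds_basis_closedBall.mem_iff.1 (hopen.mem_nhds hx)
  exact ⟨ε, hε, fun y hy => hsub hy⟩

theorem IsSubharmonic.exists_bound_on_spheres {F : Set (SymMat n)}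
    (hv : IsSubharmonic F (annulus n a b) v) {x : Rn n} (hx : x ∈ annulus n a b) :
    ∃ M : ℝ, ∃ ε > 0, ∀ y ∈ Metric.closedBall x ε, ∀ z, ‖z‖ = ‖y‖ →
      z ∈ annulus n a b ∧ v z ≤ M := by
  obtain ⟨ε, hε, hsub⟩ := exists_norm_sub_norm_le_subset_annulus hx
  have hK : IsCompact {y : Rn n | |‖y‖ - ‖x‖| ≤ ε} :=
    isCompact_norm_preimage (isCompact_closedBall ‖x‖ ε)
  obtain ⟨M, hM⟩ := exists_real_le_of_upperSemicontinuousOn hK (hv.usc.mono hsub)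
    fun y hy => hv.lt_top y (hsub y hy)
  refine ⟨M, ε, hε, fun y hy z hz => ?_⟩
  have hzx : |‖z‖ - ‖x‖| ≤ ε :=
    hz ▸ (abs_norm_sub_norm_le y x).trans (mem_closedBall_iff_norm.1 hy)
  exact ⟨hsub z hzx, hM z hzx⟩

theorem sphericalAverage_congr {x : Rn n} (h : ∀ y, ‖y‖ = ‖x‖ → v y = w y) :
    sphericalAverage v ‖x‖ = sphericalAverage w ‖x‖ := by
  have hσ (σ : unitSphere n) : v (‖x‖ • (σ : Rn n)) = w (‖x‖ • (σ : Rn n)) :=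
    h _ (by rw [norm_smul_unitSphere, abs_norm])
  simp only [sphericalAverage, hσ]

theorem mem_annulus_of_norm_eq {x y : Rn n} (hx : x ∈ annulus n a b) (h : ‖y‖ = ‖x‖) :
    y ∈ annulus n a b := by
  rwa [annulus, Set.mem_ofPred_eq, h]

theorem norm_smul_mem_annulus {x : Rn n} (hx : x ∈ annulus n a b) (σ : unitSphere n) :
    ‖x‖ • (σ : Rn n) ∈ annulus n a b :=
  mem_annulus_of_norm_eq hx (by rw [norm_smul_unitSphere, abs_norm])

theorem lowerSemicontinuousAt_lintegral_deficit (hv : UpperSemicontinuousOn v (annulus n a b))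
    (hvm : Measurable v) (M : ℝ) {x : Rn n} (hx : x ∈ annulus n a b) :
    LowerSemicontinuousAt (fun y : Rn n =>
      ∫⁻ σ : unitSphere n, deficit M (v (‖y‖ • (σ : Rn n))) ∂sphereMeasure n) x := by
  rw [lowerSemicontinuousAt_iff_le_liminf]
  refine le_trans (lintegral_mono fun σ => ?_) (lintegral_liminf_le fun y =>
    (continuous_deficit M).measurable.comp (hvm.comp (by fun_prop)))
  have hσ := norm_smul_mem_annulus hx σ
  have hlsc : LowerSemicontinuousAt (fun y => deficit M (v y)) (‖x‖ • (σ : Rn n)) := by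
    have := (continuous_deficit M).comp_upperSemicontinuousOn_antitone hv (antitone_deficit M)
    simpa only [LowerSemicontinuousAt, LowerSemicontinuousWithinAt, SemicontinuousAt,
      SemicontinuousWithinAt, (isOpen_annulus n a b).nhdsWithin_eq hσ] using! this _ hσ
  have hc : ContinuousAt (fun y : Rn n => ‖y‖ • (σ : Rn n)) x := by fun_prop
  exact lowerSemicontinuousAt_iff_le_liminf.1 fun c hcx =>
    hc.eventually (p := fun z => c < deficit M (v z)) (hlsc c hcx)

theorem IsSubharmonic.upperSemicontinuousAt_sphericalAverage [Nonempty (unitSphere n)]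
    {F : Set (SymMat n)} (hv : IsSubharmonic F (annulus n a b) v) (hvm : Measurable v) {x : Rn n}
    (hx : x ∈ annulus n a b) : UpperSemicontinuousAt (fun y => sphericalAverage v ‖y‖) x := by
  obtain ⟨M, ε, hε, hM⟩ := hv.exists_bound_on_spheres hx
  have hM' : ∀ᶠ y in 𝓝 x, ∀ σ : unitSphere n, v (‖y‖ • (σ : Rn n)) ≤ M := by
    filter_upwards [Metric.closedBall_mem_nhds x hε] with y hy σ
    exact (hM y hy _ (by rw [norm_smul_unitSphere, abs_norm])).2
  refine upperSemicontinuousAt_of_deficit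
    (hM'.mono fun y hy => sphericalAverage_le hvm hy) fun c hc => ?_
  simp only [gt_iff_lt, deficit_sphericalAverage hvm hM'.self_of_nhds] at hc ⊢
  filter_upwards [hM', lowerSemicontinuousAt_lintegral_deficit hv.usc hvm M hx c hc] with y hy hcy
  rwa [deficit_sphericalAverage hvm hy]

end Annulus

section Average

variable [Nonempty (unitSphere n)] {F : Set (SymMat n)}

theorem IsSubharmonic.lintegral_lintegral_deficit_le {ℓ : Matrix (Fin n) (Fin n) ℝ →ₗ[ℝ] ℝ}
    {μ : Measure (unitSphere n)} [IsProbabilityMeasure μ] (hμ : IsHarmonicMeasure ℓ μ)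
    (hℓ : IsElliptic ℓ) (hsub : F ⊆ halfSpace ℓ) (hF : IsClosed F) (hST : IsSTInvariant F)
    {X : Set (Rn n)} {v : Rn n → EReal} (hv : IsSubharmonic F X v) (hvm : Measurable v)
    {b x : Rn n} {r M : ℝ} (hr : 0 < r)
    (hM : ∀ y ∈ Metric.closedBall x r, ∀ z, ‖z‖ = ‖y‖ → b + z ∈ X ∧ v (b + z) ≤ M) :
    ∫⁻ σ : unitSphere n, ∫⁻ τ : unitSphere n,
        deficit M (v (b + ‖x + r • (σ : Rn n)‖ • (τ : Rn n))) ∂sphereMeasure n ∂μ ≤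
      ∫⁻ τ : unitSphere n, deficit M (v (b + ‖x‖ • (τ : Rn n))) ∂sphereMeasure n := by
  obtain ⟨Γ, η, hη, hΓ, havg⟩ := hST.exists_averaging_measure hF
  have hD : Measurable fun y => deficit M (v (b + y)) :=
    (continuous_deficit M).measurable.comp (hvm.comp (by fun_prop))
  simp only [← havg _ hD]
  calc ∫⁻ σ : unitSphere n, ∫⁻ g : Γ, deficit M (v (b + isometry (g : Matrix.orthogonalGroup _ ℝ)
        (x + r • (σ : Rn n)))) ∂η ∂μ
      = ∫⁻ g : Γ, ∫⁻ σ : unitSphere n, deficit M (v (b + isometry (g : Matrix.orthogonalGroup _ ℝ)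
          (x + r • (σ : Rn n)))) ∂μ ∂η := by
        refine lintegral_lintegral_swap (hD.comp (Continuous.measurable ?_)).aemeasurable
        simp only [isometry_apply, Matrix.toLpLin_apply]
        fun_prop
    _ ≤ ∫⁻ g : Γ, deficit M (v (b + isometry (g : Matrix.orthogonalGroup _ ℝ) x)) ∂η :=
        lintegral_mono fun g => by
          have hvg := (hv.comp_isometry (hΓ _ (Γ.inv_mem g.2)) b).mono hsub
          exact hμ.lintegral_deficit_le hℓ hvg hr (fun y hy => (hM y hy _ (by simp)).1)
            fun y hy => (hM y hy _ (by simp)).2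

theorem IsSubharmonic.lintegral_sphere_deficit_le (hF : IsSubequation F) (hcone : IsCone F)
    (hconv : Convex ℝ F) (hST : IsSTInvariant F) (hne : F.Nonempty) (huniv : F ≠ Set.univ)
    {X : Set (Rn n)} {v : Rn n → EReal} (hv : IsSubharmonic F X v) (hvm : Measurable v)
    {x : Rn n} {r M : ℝ} (hr : 0 < r) (hX : Metric.closedBall x r ⊆ X)
    (hM : ∀ y ∈ Metric.closedBall x r, v y ≤ M) :
    ∫⁻ τ : unitSphere n, deficit M (v (x + r • (τ : Rn n))) ∂sphereMeasure n ≤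
      deficit M (v x) := by
  obtain ⟨E, hE⟩ : ∃ E, E ∉ interior F := by
    by_contra! h
    exact huniv (Set.eq_univ_of_forall fun A => interior_subset (h A))
  obtain ⟨ℓ, hℓ, hsub, -⟩ := exists_isElliptic_subset_halfSpace hF hcone hconv hne hE
  obtain ⟨μ, hμprob, hμ⟩ := hℓ.exists_isHarmonicMeasure
  have hball (y : Rn n) (hy : y ∈ Metric.closedBall 0 r) (z : Rn n) (hz : ‖z‖ = ‖y‖) :
      x + z ∈ Metric.closedBall x r := by
    rwa [mem_closedBall_iff_norm, add_sub_cancel_left, hz, ← mem_closedBall_zero_iff]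
  simpa [norm_smul, abs_of_pos hr] using
    hv.lintegral_lintegral_deficit_le hμ hℓ hsub hF.isClosed hST hvm (b := x) (x := 0) hr
      fun y hy z hz => ⟨hX (hball y hy z hz), hM _ (hball y hy z hz)⟩

theorem IsSubharmonic.sphericalAverage_norm_of_measurable (hF : IsSubequation F) (hcone : IsCone F)
    (hconv : Convex ℝ F) (hST : IsSTInvariant F) (hne : F.Nonempty) {a : ℝ} {b : EReal}
    {v : Rn n → EReal} (hv : IsSubharmonic F (annulus n a b) v) (hvm : Measurable v) :
    IsSubharmonic F (annulus n a b) fun x => sphericalAverage v ‖x‖ := by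
  have hσ (y : Rn n) (σ : unitSphere n) : ‖‖y‖ • (σ : Rn n)‖ = ‖y‖ := by
    rw [norm_smul_unitSphere, abs_norm]
  have husc : UpperSemicontinuousOn (fun x => sphericalAverage v ‖x‖) (annulus n a b) :=
    fun x hx => (hv.upperSemicontinuousAt_sphericalAverage hvm hx).upperSemicontinuousWithinAt _
  have hlt (x : Rn n) (hx : x ∈ annulus n a b) : sphericalAverage v ‖x‖ < ⊤ := by
    obtain ⟨M, ε, hε, hM⟩ := hv.exists_bound_on_spheres hx
    exact (sphericalAverage_le hvm fun σ => (hM x (Metric.mem_closedBall_self hε.le) _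
      (hσ x σ)).2).trans_lt (EReal.coe_lt_top M)
  refine isSubharmonic_of_forall_isElliptic hF hcone hconv hne husc hlt fun ℓ hℓ hsub => ?_
  obtain ⟨μ, hμprob, hμ⟩ := hℓ.exists_isHarmonicMeasure
  refine hμ.isSubharmonic_of_lintegral_deficit_le hℓ husc hlt fun x hx => ?_
  obtain ⟨M, ε, hε, hM⟩ := hv.exists_bound_on_spheres hx
  have hxε : x ∈ Metric.closedBall x ε := Metric.mem_closedBall_self hε.le
  have hdeficit (y : Rn n) (hy : y ∈ Metric.closedBall x ε) :
      deficit M (sphericalAverage v ‖y‖) =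
        ∫⁻ τ : unitSphere n, deficit M (v (‖y‖ • (τ : Rn n))) ∂sphereMeasure n :=
    deficit_sphericalAverage hvm fun σ => (hM y hy _ (hσ y σ)).2
  refine ⟨M, sphericalAverage_le hvm fun σ => (hM x hxε _ (hσ x σ)).2, ?_⟩
  filter_upwards [Ioo_mem_nhdsGT hε] with r hr
  have hmean := hv.lintegral_lintegral_deficit_le hμ hℓ hsub hF.isClosed hST hvm (b := 0)
    (x := x) hr.1 fun y hy z hz => by
      rw [zero_add]
      exact hM y (Metric.closedBall_subset_closedBall hr.2.le hy) z hz
  simp only [zero_add] at hmean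
  rw [hdeficit x hxε]
  refine (lintegral_mono fun σ => (hdeficit _ ?_).le).trans hmean
  rw [mem_closedBall_iff_norm, add_sub_cancel_left, norm_smul_unitSphere, abs_of_pos hr.1]
  exact hr.2.le

theorem IsSubharmonic.sphericalAverage_norm (hF : IsSubequation F) (hcone : IsCone F)
    (hconv : Convex ℝ F) (hST : IsSTInvariant F) (hne : F.Nonempty) {a : ℝ} {b : EReal}
    {v : Rn n → EReal} (hv : IsSubharmonic F (annulus n a b) v) :
    IsSubharmonic F (annulus n a b) fun x => sphericalAverage v ‖x‖ := by
  have hX := isOpen_annulus n a b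
  obtain ⟨v', hvm, hv'⟩ := exists_measurable_eqOn_of_upperSemicontinuousOn hX hv.usc
  have hSv' := (hv.congr hX hv').sphericalAverage_norm_of_measurable hF hcone hconv hST hne hvm
  exact hSv'.congr hX fun x hx =>
    sphericalAverage_congr fun y hy => (hv' (mem_annulus_of_norm_eq hx hy)).symm

end Average

/-! ### Comparison with Riesz kernels -/

/-- The radial profile, as a function of `q = ‖x‖ ^ 2`, of the Riesz kernel of characteristic `p`:
up to positive factors, `‖x‖ ^ (2 - p) / (2 - p)`, and `log ‖x‖` for `p = 2`. -/
def rieszProfile (p q : ℝ) : ℝ :=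
  if p = 2 then Real.log q else q ^ (-p / 2 + 1) / (-p / 2 + 1)

section RieszProfile

variable {p q : ℝ} {x : Rn n}

theorem hasDerivAt_rieszProfile (hq : 0 < q) :
    HasDerivAt (rieszProfile p) (q ^ (-p / 2)) q := by
  unfold rieszProfile
  split_ifs with hp
  · simpa [hp, neg_div, Real.rpow_neg_one] using Real.hasDerivAt_log hq.ne'
  · have hp' : -p / 2 + 1 ≠ 0 := fun h => hp (by linarith)
    refine ((Real.hasDerivAt_rpow_const (.inl hq.ne')).div_const _).congr_deriv ?_
    rw [add_sub_cancel_right, mul_div_cancel_left₀ _ hp']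

theorem contDiffAt_rieszProfile (hq : 0 < q) : ContDiffAt ℝ 2 (rieszProfile p) q := by
  unfold rieszProfile
  split_ifs
  · exact Real.contDiffAt_log.2 hq.ne'
  · exact (Real.contDiffAt_rpow_const_of_ne hq.ne').div_const _

theorem strictMonoOn_rieszProfile : StrictMonoOn (rieszProfile p) (Set.Ioi 0) := by
  refine strictMonoOn_of_deriv_pos (convex_Ioi 0)
    (fun q hq => (hasDerivAt_rieszProfile hq).continuousAt.continuousWithinAt) fun q hq => ?_
  rw [interior_Ioi] at hq
  rw [(hasDerivAt_rieszProfile hq).deriv]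
  exact Real.rpow_pos_of_pos hq _

theorem contDiffAt_rieszProfile_norm_sq (hx : x ≠ 0) :
    ContDiffAt ℝ 2 (fun y => rieszProfile p (‖y‖ ^ 2)) x :=
  (contDiffAt_rieszProfile (by positivity)).comp x (contDiff_norm_sq ℝ).contDiffAt

theorem hessian_rieszProfile_norm_sq (hx : x ≠ 0) :
    hessian (fun y => rieszProfile p (‖y‖ ^ 2)) x =
      (2 * (‖x‖ ^ 2) ^ (-p / 2)) • (rieszMat p (‖x‖⁻¹ • x) : Matrix (Fin n) (Fin n) ℝ) := by
  have hq : 0 < ‖x‖ ^ 2 := by positivity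
  rw [hessian_comp_norm_sq
    (by filter_upwards [lt_mem_nhds hq] with q hq' using hasDerivAt_rieszProfile hq')
    (Real.hasDerivAt_rpow_const (.inl hq.ne')), Real.rpow_sub_one hq.ne']
  ext i j
  simp only [rieszMat, Matrix.add_apply, Matrix.smul_apply, Matrix.sub_apply,
    Matrix.vecMulVec_apply, PiLp.smul_apply, smul_eq_mul]
  field_simp
  ring

theorem contDiffAt_mul_rieszProfile_add (hx : x ≠ 0) (α c : ℝ) :
    ContDiffAt ℝ 2 (fun y => α * rieszProfile p (‖y‖ ^ 2) + c) x :=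
  (contDiffAt_const.mul (contDiffAt_rieszProfile_norm_sq hx)).add contDiffAt_const

theorem exists_hessian_mul_rieszProfile_add (hx : x ≠ 0) {α : ℝ} (hα : 0 ≤ α) (c : ℝ) :
    ∃ s ≥ (0 : ℝ), ∃ e : unitSphere n, hessian (fun y => α * rieszProfile p (‖y‖ ^ 2) + c) x =
      (s • rieszMat p e : SymMat n) := by
  refine ⟨α * (2 * (‖x‖ ^ 2) ^ (-p / 2)), by positivity,
    ⟨‖x‖⁻¹ • x, mem_sphere_zero_iff_norm.2 (norm_smul_inv_norm (𝕜 := ℝ) hx)⟩, ?_⟩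
  have hk := contDiffAt_rieszProfile_norm_sq (p := p) hx
  rw [hessian_add (contDiffAt_const.mul hk) contDiffAt_const, hessian_const_mul hk, hessian_const,
    hessian_rieszProfile_norm_sq hx, smul_smul, add_zero, selfAdjoint.val_smul]

end RieszProfile

section Frontier

variable {F : Set (SymMat n)} {A : SymMat n} {s ε : ℝ}

theorem IsSubequation.smul_add_mem_interior (hF : IsSubequation F) (hcone : IsCone F)
    (hA : A ∈ frontier F) (hs : 0 ≤ s) (hε : 0 < ε) :
    s • A + ε • (1 : SymMat n) ∈ interior F :=
  hF.add_smul_one_mem_interior (hcone s hs A (hF.isClosed.frontier_subset hA)) hε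

theorem IsSubequation.smul_sub_notMem (hF : IsSubequation F) (hcone : IsCone F)
    (hA : A ∈ frontier F) (hs : 0 ≤ s) (hε : 0 < ε) : s • A - ε • (1 : SymMat n) ∉ F := by
  intro h
  rcases hs.eq_or_lt with rfl | hs
  · have huniv := hF.eq_univ_of_neg_one_mem hcone
      (by simpa [smul_smul, hε.ne'] using hcone ε⁻¹ (by positivity) _ h)
    simp [huniv] at hA
  · refine hA.2 ?_
    simpa [smul_sub, smul_smul, hs.ne'] using
      hF.add_smul_one_mem_interior (hcone s⁻¹ (by positivity) _ h) (ε := s⁻¹ * ε) (by positivity)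

end Frontier

section Comparison

variable {F : Set (SymMat n)} {p a : ℝ} {b : EReal} {t₁ t₂ : ℝ} {w : Rn n → EReal}
  {h : ℝ → EReal} {α c : ℝ}

theorem norm_preimage_Icc_subset_annulus (ht₁ : a < t₁) (ht₂ : (t₂ : EReal) < b) :
    (norm ⁻¹' Set.Icc t₁ t₂ : Set (Rn n)) ⊆ annulus n a b :=
  fun _ hx => ⟨ht₁.trans_le hx.1, (EReal.coe_le_coe_iff.2 hx.2).trans_lt ht₂⟩

theorem IsSubharmonic.le_of_le_on_spheres (hw : IsSubharmonic F (annulus n a b) w) (ha : 0 ≤ a)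
    (ht₁ : a < t₁) (ht₂ : (t₂ : EReal) < b) {φ : Rn n → ℝ} (hφ : ∀ x ≠ 0, ContDiffAt ℝ 2 φ x)
    (hstrict : ∀ x ≠ 0, ∀ ε > (0 : ℝ), ∀ A ∈ F,
      (A : Matrix (Fin n) (Fin n) ℝ) ≠ hessian φ x - ε • 1)
    (hbd : ∀ y, ‖y‖ = t₁ ∨ ‖y‖ = t₂ → w y ≤ φ y) :
    ∀ y ∈ (norm ⁻¹' Set.Icc t₁ t₂ : Set (Rn n)), w y ≤ φ y := by
  have hne (x : Rn n) (hx : x ∈ (norm ⁻¹' Set.Icc t₁ t₂ : Set (Rn n))) : x ≠ 0 :=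
    norm_pos_iff.1 (ha.trans_lt (ht₁.trans_le hx.1))
  refine hw.le_of_le_on_frontier (isCompact_norm_preimage isCompact_Icc)
    (norm_preimage_Icc_subset_annulus ht₁ ht₂)
    (fun x hx => (hφ x (hne x hx)).continuousAt.continuousWithinAt)
    (fun x hx => hφ x (hne x (interior_subset hx)))
    (fun x hx => hstrict x (hne x (interior_subset hx))) fun y hy => hbd y ?_
  have hy' := continuous_norm.frontier_preimage_subset _ hy
  have hle : t₁ ≤ t₂ := by
    by_contra! hlt
    simp [Set.Icc_eq_empty_of_lt hlt] at hy'
  simpa [frontier_Icc hle] using hy'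

theorem IsSubharmonic.le_rieszProfile (hF : IsSubequation F) (hcone : IsCone F)
    (hp : ∀ e : unitSphere n, rieszMat p e ∈ frontier F)
    (hw : IsSubharmonic F (annulus n a b) w) (ha : 0 ≤ a) (ht₁ : a < t₁) (ht₂ : (t₂ : EReal) < b)
    (hα : 0 ≤ α)
    (hbd : ∀ y, ‖y‖ = t₁ ∨ ‖y‖ = t₂ → w y ≤ (α * rieszProfile p (‖y‖ ^ 2) + c : ℝ)) :
    ∀ y ∈ (norm ⁻¹' Set.Icc t₁ t₂ : Set (Rn n)),
      w y ≤ (α * rieszProfile p (‖y‖ ^ 2) + c : ℝ) := by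
  refine hw.le_of_le_on_spheres ha ht₁ ht₂ (fun x hx => contDiffAt_mul_rieszProfile_add hx α c)
    (fun x hx ε hε A hA hAφ => ?_) hbd
  obtain ⟨s, hs, e, he⟩ := exists_hessian_mul_rieszProfile_add (p := p) hx hα c
  refine hF.smul_sub_notMem hcone (hp e) hs hε ?_
  convert hA
  exact Subtype.ext (by simp [hAφ, he])

theorem IsSubharmonic.rieszProfile_le (hF : IsSubequation F) (hcone : IsCone F)
    (hp : ∀ e : unitSphere n, rieszMat p e ∈ frontier F)
    (hw : IsSubharmonic (dual F) (annulus n a b) fun x => -w x) (ha : 0 ≤ a) (ht₁ : a < t₁)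
    (ht₂ : (t₂ : EReal) < b) (hα : 0 ≤ α)
    (hbd : ∀ y, ‖y‖ = t₁ ∨ ‖y‖ = t₂ → (α * rieszProfile p (‖y‖ ^ 2) + c : ℝ) ≤ w y) :
    ∀ y ∈ (norm ⁻¹' Set.Icc t₁ t₂ : Set (Rn n)),
      (α * rieszProfile p (‖y‖ ^ 2) + c : ℝ) ≤ w y := by
  have hneg (y : Rn n) : -w y ≤ (-(α * rieszProfile p (‖y‖ ^ 2) + c) : ℝ) ↔
      (α * rieszProfile p (‖y‖ ^ 2) + c : ℝ) ≤ w y := by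
    rw [EReal.coe_neg, EReal.neg_le_neg_iff]
  simp only [← hneg] at hbd ⊢
  refine hw.le_of_le_on_spheres ha ht₁ ht₂
    (fun x hx => (contDiffAt_mul_rieszProfile_add hx α c).neg)
    (fun x hx ε hε A hA hAφ => hA ?_) hbd
  obtain ⟨s, hs, e, he⟩ := exists_hessian_mul_rieszProfile_add (p := p) hx hα c
  convert hF.smul_add_mem_interior hcone (hp e) hs hε
  refine Subtype.ext ?_
  rw [hessian_neg (contDiffAt_mul_rieszProfile_add hx α c), he] at hAφ
  simp [hAφ, add_comm]

theorem exists_mul_rieszProfile_add_eq (p : ℝ) (ht₁ : 0 < t₁) (ht : t₁ < t₂) {h₁ h₂ : ℝ}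
    (h : h₁ ≤ h₂) : ∃ α ≥ 0, ∃ c, α * rieszProfile p (t₁ ^ 2) + c = h₁ ∧
      α * rieszProfile p (t₂ ^ 2) + c = h₂ := by
  have hk : 0 < rieszProfile p (t₂ ^ 2) - rieszProfile p (t₁ ^ 2) :=
    sub_pos.2 (strictMonoOn_rieszProfile (Set.mem_Ioi.2 (by positivity))
      (Set.mem_Ioi.2 (pow_pos (ht₁.trans ht) 2)) (by gcongr))
  set α := (h₂ - h₁) / (rieszProfile p (t₂ ^ 2) - rieszProfile p (t₁ ^ 2))
  have hα : α * (rieszProfile p (t₂ ^ 2) - rieszProfile p (t₁ ^ 2)) = h₂ - h₁ :=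
    div_mul_cancel₀ _ hk.ne'
  exact ⟨α, div_nonneg (sub_nonneg.2 h) hk.le, h₁ - α * rieszProfile p (t₁ ^ 2), by ring,
    by linarith⟩

theorem IsHarmonic.exists_eq_coe {X : Set (Rn n)} (hw : IsHarmonic F X w) {x : Rn n}
    (hx : x ∈ X) : ∃ r : ℝ, w x = r :=
  ⟨(w x).toReal, (EReal.coe_toReal (hw.1.lt_top x hx).ne fun h => by
    simpa [h] using hw.2.lt_top x hx).symm⟩

theorem IsSubharmonic.le_of_isHarmonic_radial [Nonempty (unitSphere n)] (hF : IsSubequation F)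
    (hcone : IsCone F) (hp : ∀ e : unitSphere n, rieszMat p e ∈ frontier F)
    (hw : IsSubharmonic F (annulus n a b) w)
    (hh : IsHarmonic F (annulus n a b) fun x => h ‖x‖) (ha : 0 ≤ a) (ht₁ : a < t₁) (ht : t₁ < t₂)
    (ht₂ : (t₂ : EReal) < b) (hmono : h t₁ ≤ h t₂)
    (hbd : ∀ y, ‖y‖ = t₁ ∨ ‖y‖ = t₂ → w y ≤ h ‖y‖) :
    ∀ y ∈ (norm ⁻¹' Set.Icc t₁ t₂ : Set (Rn n)), w y ≤ h ‖y‖ := by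
  obtain ⟨σ⟩ := ‹Nonempty (unitSphere n)›
  have ht₁0 := ha.trans_lt ht₁
  have hreal (t : ℝ) (h₁ : t₁ ≤ t) (h₂ : t ≤ t₂) : ∃ r : ℝ, h t = r := by
    have hnorm : ‖t • (σ : Rn n)‖ = t := by
      rw [norm_smul_unitSphere, abs_of_pos (ht₁0.trans_le h₁)]
    have hmem : t • (σ : Rn n) ∈ annulus n a b :=
      norm_preimage_Icc_subset_annulus ht₁ ht₂ ⟨h₁.trans_eq hnorm.symm, hnorm.trans_le h₂⟩
    simpa [hnorm] using hh.exists_eq_coe hmem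
  obtain ⟨h₁, hh₁⟩ := hreal t₁ le_rfl ht.le
  obtain ⟨h₂, hh₂⟩ := hreal t₂ ht.le le_rfl
  rw [hh₁, hh₂, EReal.coe_le_coe_iff] at hmono
  obtain ⟨α, hα, c, hc₁, hc₂⟩ := exists_mul_rieszProfile_add_eq p ht₁0 ht hmono
  have hbd' (y : Rn n) (hy : ‖y‖ = t₁ ∨ ‖y‖ = t₂) :
      h ‖y‖ = (α * rieszProfile p (‖y‖ ^ 2) + c : ℝ) := by
    rcases hy with hy | hy <;> simp only [hy, hh₁, hh₂, hc₁, hc₂]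
  intro y hy
  calc w y ≤ (α * rieszProfile p (‖y‖ ^ 2) + c : ℝ) :=
        hw.le_rieszProfile hF hcone hp ha ht₁ ht₂ hα
          (fun z hz => (hbd z hz).trans_eq (hbd' z hz)) y hy
    _ ≤ h ‖y‖ := hh.2.rieszProfile_le hF hcone hp ha ht₁ ht₂ hα
          (fun z hz => (hbd' z hz).ge) y hy

end Comparison

/-! ### From averages to pointwise values -/

section Polar

variable {E : Type*} [NormedAddCommGroup E] [NormedSpace ℝ E] [FiniteDimensional ℝ E]
  [Nontrivial E] [MeasurableSpace E] [BorelSpace E] {μ : Measure E} [μ.IsAddHaarMeasure]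
  {N : Set E}

theorem addHaar_eq_zero_iff_polar (hN : MeasurableSet N) :
    μ N = 0 ↔ ∀ᵐ r ∂Measure.volumeIoiPow (Module.finrank ℝ E - 1),
      ∀ᵐ σ : Metric.sphere (0 : E) 1 ∂μ.toSphere, r.1 • (σ : E) ∉ N := by
  set s : Set (Metric.sphere (0 : E) 1 × Set.Ioi (0 : ℝ)) := {q | q.2.1 • (q.1 : E) ∈ N}
  have hs : MeasurableSet s :=
    hN.preimage (f := fun q : Metric.sphere (0 : E) 1 × Set.Ioi (0 : ℝ) => q.2.1 • (q.1 : E))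
      (Continuous.measurable (by fun_prop))
  have hpre : homeomorphUnitSphereProd E ⁻¹' s = Subtype.val ⁻¹' N := by
    ext x
    have hx : ‖(x : E)‖ ≠ 0 := norm_ne_zero_iff.2 x.2
    simp [s, homeomorphUnitSphereProd, smul_smul, hx]
  have hprod : μ N = (μ.toSphere.prod (.volumeIoiPow (Module.finrank ℝ E - 1))) s := by
    rw [← μ.measurePreserving_homeomorphUnitSphereProd.measure_preimage hs.nullMeasurableSet,
      hpre, comap_subtype_coe_apply (measurableSet_singleton _).compl, Subtype.image_preimage_coe,
      Set.inter_comm, ← Set.sdiff_eq, measure_sdiff_null (measure_singleton _)]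
  rw [hprod, ← Measure.prod_swap, Measure.map_apply measurable_swap hs,
    Measure.measure_prod_null (measurable_swap hs)]
  refine Filter.eventually_congr (Filter.Eventually.of_forall fun r => ?_)
  rw [ae_iff]
  simp only [not_not]
  rfl

theorem frequently_of_ae_volumeIoiPow {k : ℕ} {P : ℝ → Prop}
    (hP : ∀ᵐ r ∂Measure.volumeIoiPow k, P r.1) : ∃ᶠ r in 𝓝[>] (0 : ℝ), P r := by
  rw [(nhdsGT_basis (0 : ℝ)).frequently_iff]
  intro δ hδ
  by_contra! hcon
  have hzero : Measure.volumeIoiPow k (Set.Iio (⟨δ, hδ⟩ : Set.Ioi (0 : ℝ))) = 0 :=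
    measure_mono_null (fun r hr => hcon r ⟨r.2, hr⟩) hP
  rw [Measure.volumeIoiPow_apply_Iio, ENNReal.ofReal_eq_zero] at hzero
  exact hzero.not_gt (by positivity)

theorem frequently_ae_toSphere_add_smul_notMem (hN : μ N = 0) (x : E) :
    ∃ᶠ r in 𝓝[>] (0 : ℝ), ∀ᵐ σ : Metric.sphere (0 : E) 1 ∂μ.toSphere, x + r • (σ : E) ∉ N := by
  have hnull : μ ((x + ·) ⁻¹' toMeasurable μ N) = 0 := by
    rw [measure_preimage_add, measure_toMeasurable, hN]
  have hpolar := (addHaar_eq_zero_iff_polar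
    ((measurableSet_toMeasurable μ N).preimage (measurable_const_add x))).1 hnull
  exact (frequently_of_ae_volumeIoiPow
    (P := fun r => ∀ᵐ σ : Metric.sphere (0 : E) 1 ∂μ.toSphere, r • (σ : E) ∉ _) hpolar).mono
    fun r hr => hr.mono fun σ hσ hmem => hσ (subset_toMeasurable μ N hmem)

end Polar

theorem ae_sphereMeasure_iff {P : unitSphere n → Prop} :
    (∀ᵐ σ ∂sphereMeasure n, P σ) ↔ ∀ᵐ σ ∂(volume : Measure (Rn n)).toSphere, P σ :=
  Measure.ae_ennreal_smul_measure_iff (ENNReal.inv_ne_zero.2 (measure_ne_top _ _))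

section SubmeanPointwise

variable [Nonempty (unitSphere n)] {F : Set (SymMat n)}

theorem nontrivial_of_nonempty_unitSphere : Nontrivial (Rn n) := by
  obtain ⟨σ⟩ := ‹Nonempty (unitSphere n)›
  exact ⟨σ, 0, ne_of_mem_of_not_mem σ.2 (by simp)⟩

theorem IsSubharmonic.le_of_ae_le (hF : IsSubequation F) (hcone : IsCone F) (hconv : Convex ℝ F)
    (hST : IsSTInvariant F) (hne : F.Nonempty) (huniv : F ≠ Set.univ) {X : Set (Rn n)}
    (hX : IsOpen X) {u v : Rn n → EReal} (hv : IsSubharmonic F X v) (hvm : Measurable v)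
    (hu : UpperSemicontinuousOn u X) (h : ∀ᵐ y, y ∈ X → v y ≤ u y) {x : Rn n} (hx : x ∈ X) :
    v x ≤ u x := by
  have := nontrivial_of_nonempty_unitSphere (n := n)
  obtain ⟨ε, hε, hεX⟩ := Metric.nhds_basis_closedBall.mem_iff.1 (hX.mem_nhds hx)
  obtain ⟨M, hM⟩ := exists_real_le_of_upperSemicontinuousOn (isCompact_closedBall x ε)
    (hv.usc.mono hεX) fun y hy => hv.lt_top y (hεX hy)
  rw [← deficit_le_deficit_iff (hM x (Metric.mem_closedBall_self hε.le))]
  refine le_of_forall_lt_imp_le_of_dense fun c hc => ?_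
  have hlsc : ∀ᶠ y in 𝓝 x, c < deficit M (u y) := by
    have := (continuous_deficit M).comp_upperSemicontinuousOn_antitone hu (antitone_deficit M)
    simpa only [hX.nhdsWithin_eq hx] using! this x hx c hc
  obtain ⟨δ, hδ, hball⟩ := Metric.eventually_nhds_iff_ball.1 hlsc
  -- Arbitrarily small spheres about `x` meet the exceptional null set in a null set; on them the
  -- deficit of `v` exceeds every `c` below the deficit of `u` at `x`.
  obtain ⟨r, hr, hr0, hrδε⟩ := ((frequently_ae_toSphere_add_smul_notMem h x).and_eventually
    (Ioo_mem_nhdsGT (lt_min hδ hε))).exists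
  have hrε : Metric.closedBall x r ⊆ Metric.closedBall x ε :=
    Metric.closedBall_subset_closedBall (hrδε.le.trans (min_le_right _ _))
  have hσ (σ : unitSphere n) : dist (x + r • (σ : Rn n)) x = r := by
    rw [dist_self_add_left, norm_smul_unitSphere, abs_of_pos hr0]
  calc c = ∫⁻ _ : unitSphere n, c ∂sphereMeasure n := by simp
    _ ≤ ∫⁻ σ : unitSphere n, deficit M (v (x + r • (σ : Rn n))) ∂sphereMeasure n := by
        refine lintegral_mono_ae ?_
        filter_upwards [ae_sphereMeasure_iff.2 hr] with σ hσN
        have hσX : x + r • (σ : Rn n) ∈ X := hεX (hrε (hσ σ).le)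
        exact (hball _ ((hσ σ).trans_lt (hrδε.trans_le (min_le_left _ _)))).le.trans
          (antitone_deficit M (of_not_not hσN hσX))
    _ ≤ deficit M (v x) := hv.lintegral_sphere_deficit_le hF hcone hconv hST hne huniv hvm hr0
        (hrε.trans hεX) fun y hy => hM y (hrε hy)

theorem ae_sphere_le_of_sphericalAverage_le {u v : Rn n → EReal} (hu : Measurable u)
    (hv : Measurable v) {t M : ℝ} (hM : ∀ σ : unitSphere n, v (t • (σ : Rn n)) ≤ M)
    (huv : ∀ σ : unitSphere n, u (t • (σ : Rn n)) ≤ v (t • (σ : Rn n)))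
    (hbot : sphericalAverage u t ≠ ⊥) (hle : sphericalAverage v t ≤ sphericalAverage u t) :
    ∀ᵐ σ : unitSphere n ∂sphereMeasure n, v (t • (σ : Rn n)) ≤ u (t • (σ : Rn n)) := by
  have huM (σ : unitSphere n) : u (t • (σ : Rn n)) ≤ M := (huv σ).trans (hM σ)
  have hdeficit := antitone_deficit M hle
  have hfin := deficit_ne_top M hbot
  rw [deficit_sphericalAverage hu huM] at hdeficit hfin
  rw [deficit_sphericalAverage hv hM] at hdeficit
  have hpt (σ : unitSphere n) : deficit M (v (t • (σ : Rn n))) ≤ deficit M (u (t • (σ : Rn n))) :=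
    antitone_deficit M (huv σ)
  have hmeas : Measurable fun σ : unitSphere n => deficit M (u (t • (σ : Rn n))) :=
    (continuous_deficit M).measurable.comp (hu.comp (by fun_prop))
  filter_upwards [ae_eq_of_ae_le_of_lintegral_le
    (Filter.Eventually.of_forall hpt) (ne_top_of_le_ne_top hfin (lintegral_mono hpt))
    hmeas.aemeasurable hdeficit] with σ hσ
  exact (deficit_le_deficit_iff (hM σ)).1 hσ.ge

theorem IsSubharmonic.ae_le_of_sphericalAverage_le {a : ℝ} {b : EReal} {u v : Rn n → EReal}
    (hv : IsSubharmonic F (annulus n a b) v) (hvm : Measurable v) (hum : Measurable u)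
    (huv : ∀ x ∈ annulus n a b, u x ≤ v x)
    (hbot : ∀ x ∈ annulus n a b, sphericalAverage u ‖x‖ ≠ ⊥)
    (hle : ∀ x ∈ annulus n a b, sphericalAverage v ‖x‖ ≤ sphericalAverage u ‖x‖) :
    ∀ᵐ x, x ∈ annulus n a b → v x ≤ u x := by
  have := nontrivial_of_nonempty_unitSphere (n := n)
  suffices volume (annulus n a b ∩ {x | v x ≤ u x}ᶜ) = 0 by
    filter_upwards [compl_mem_ae_iff.2 this] with x hx hxX
    exact not_not.1 fun h => hx ⟨hxX, h⟩
  rw [addHaar_eq_zero_iff_polar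
    ((isOpen_annulus n a b).measurableSet.inter (measurableSet_le hvm hum).compl)]
  refine Filter.Eventually.of_forall fun r => ?_
  have hr (σ : unitSphere n) : ‖r.1 • (σ : Rn n)‖ = r := by
    rw [norm_smul_unitSphere, abs_of_pos r.2]
  by_cases hrX : ∃ x ∈ annulus n a b, ‖x‖ = r
  · obtain ⟨x, hx, hxr⟩ := hrX
    have hσ (σ : unitSphere n) : r.1 • (σ : Rn n) ∈ annulus n a b :=
      mem_annulus_of_norm_eq hx ((hr σ).trans hxr.symm)
    obtain ⟨M, ε, hε, hM⟩ := hv.exists_bound_on_spheres hx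
    filter_upwards [ae_sphereMeasure_iff.1 (ae_sphere_le_of_sphericalAverage_le hum hvm
      (fun σ => (hM x (Metric.mem_closedBall_self hε.le) _ ((hr σ).trans hxr.symm)).2)
      (fun σ => huv _ (hσ σ)) (hxr ▸ hbot x hx) (hxr ▸ hle x hx))] with σ hle hmem
    exact hmem.2 hle
  · exact Filter.Eventually.of_forall fun σ hmem => hrX ⟨_, hmem.1, hr σ⟩

theorem IsSubharmonic.le_of_sphericalAverage_le (hF : IsSubequation F) (hcone : IsCone F)
    (hconv : Convex ℝ F) (hST : IsSTInvariant F) (hne : F.Nonempty) (huniv : F ≠ Set.univ)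
    {a : ℝ} {b : EReal} {u v : Rn n → EReal} (hv : IsSubharmonic F (annulus n a b) v)
    (hu : UpperSemicontinuousOn u (annulus n a b)) (huv : ∀ x ∈ annulus n a b, u x ≤ v x)
    (hbot : ∀ x ∈ annulus n a b, sphericalAverage u ‖x‖ ≠ ⊥)
    (hle : ∀ x ∈ annulus n a b, sphericalAverage v ‖x‖ ≤ sphericalAverage u ‖x‖)
    {x : Rn n} (hx : x ∈ annulus n a b) : v x ≤ u x := by
  have hX := isOpen_annulus n a b
  obtain ⟨u', hum, hu'⟩ := exists_measurable_eqOn_of_upperSemicontinuousOn hX hu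
  obtain ⟨v', hvm, hv'⟩ := exists_measurable_eqOn_of_upperSemicontinuousOn hX hv.usc
  have hS {w w' : Rn n → EReal} (h : Set.EqOn w' w (annulus n a b)) {y : Rn n}
      (hy : y ∈ annulus n a b) : sphericalAverage w' ‖y‖ = sphericalAverage w ‖y‖ :=
    sphericalAverage_congr fun z hz => h (mem_annulus_of_norm_eq hy hz)
  have hvsub : IsSubharmonic F (annulus n a b) v' := hv.congr hX hv'
  have hae := hvsub.ae_le_of_sphericalAverage_le hvm hum
    (fun y hy => by rw [hu' hy, hv' hy]; exact huv y hy)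
    (fun y hy => by rw [hS hu' hy]; exact hbot y hy)
    fun y hy => by rw [hS hu' hy, hS hv' hy]; exact hle y hy
  rw [← hv' hx]
  refine hvsub.le_of_ae_le hF hcone hconv hST hne huniv hX hvm hu ?_ hx
  filter_upwards [hae] with y hy hyX
  exact (hy hyX).trans_eq (hu' hyX)

end SubmeanPointwise

section Maximality

variable {F : Set (SymMat n)}

theorem IsHarmonic.nonempty {X : Set (Rn n)} {w : Rn n → EReal} (hX : IsOpen X)
    (hw : IsHarmonic F X w) {x : Rn n} (hx : x ∈ X) : F.Nonempty := by
  obtain ⟨r, hr⟩ := hw.exists_eq_coe hx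
  exact hw.1.nonempty_of_ne_bot hX hx (hr ▸ EReal.coe_ne_bot r)

theorem IsHarmonic.ne_univ {X : Set (Rn n)} {w : Rn n → EReal} (hX : IsOpen X)
    (hw : IsHarmonic F X w) {x : Rn n} (hx : x ∈ X) : F ≠ Set.univ := by
  rintro rfl
  obtain ⟨r, hr⟩ := hw.exists_eq_coe hx
  obtain ⟨A, hA⟩ := hw.2.nonempty_of_ne_bot hX hx (by simp [hr])
  simp [dual] at hA

theorem exists_subset_annulus_of_isCompact {K : Set (Rn n)} (hK : IsCompact K) (hne : K.Nonempty)
    {a : ℝ} {b : EReal} (hKX : K ⊆ annulus n a b) :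
    ∃ t₁ t₂ : ℝ, a < t₁ ∧ (t₂ : EReal) < b ∧ K ⊆ annulus n t₁ t₂ := by
  obtain ⟨y₁, hy₁, hmin⟩ := hK.exists_isMinOn hne continuous_norm.continuousOn
  obtain ⟨y₂, hy₂, hmax⟩ := hK.exists_isMaxOn hne continuous_norm.continuousOn
  obtain ⟨t₁, ht₁, ht₁y⟩ := exists_between (hKX hy₁).1
  obtain ⟨t₂, hyt₂, ht₂⟩ := EReal.lt_iff_exists_real_btwn.1 (hKX hy₂).2
  exact ⟨t₁, t₂, ht₁, ht₂, fun y hy => ⟨ht₁y.trans_le (hmin hy),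
    (EReal.coe_le_coe_iff.2 (hmax hy)).trans_lt hyt₂⟩⟩

theorem nonempty_unitSphere_of_ne_zero {x : Rn n} (hx : x ≠ 0) : Nonempty (unitSphere n) :=
  ⟨⟨‖x‖⁻¹ • x, mem_sphere_zero_iff_norm.2 (norm_smul_inv_norm (𝕜 := ℝ) hx)⟩⟩

theorem IsHarmonic.isMaximal_radial (hF : IsSubequation F) (hcone : IsCone F)
    (hconv : Convex ℝ F) (hST : IsSTInvariant F) {a : ℝ} {b : EReal} (ha : 0 ≤ a) {h : ℝ → EReal}
    (hmono : MonotoneOn h {t : ℝ | a < t ∧ (t : EReal) < b})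
    (hh : IsHarmonic F (annulus n a b) fun x => h ‖x‖) :
    IsMaximal F (annulus n a b) fun x => h ‖x‖ := by
  refine ⟨hh.1, fun v hv K hKX hK hvh x₀ hx₀ => ?_⟩
  have hX := isOpen_annulus n a b
  have := nonempty_unitSphere_of_ne_zero (norm_pos_iff.1 (ha.trans_lt hx₀.1))
  obtain ⟨p, hp⟩ := exists_rieszCharacteristic hF hcone hconv hST (hh.nonempty hX hx₀)
    (hh.ne_univ hX hx₀)
  obtain ⟨t₁, t₂, ht₁, ht₂, hKt⟩ := exists_subset_annulus_of_isCompact (hK.insert x₀)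
    (Set.insert_nonempty x₀ K) (Set.insert_subset hx₀ hKX)
  obtain ⟨ht₁x, hxt₂⟩ := hKt (Set.mem_insert x₀ K)
  have hxt₂' : ‖x₀‖ < t₂ := EReal.coe_lt_coe_iff.1 hxt₂
  have ht := ht₁x.trans hxt₂'
  refine hv.le_of_isHarmonic_radial hF hcone hp hh ha ht₁ ht ht₂
    (hmono ⟨ht₁, (EReal.coe_lt_coe_iff.2 ht).trans ht₂⟩ ⟨ht₁.trans ht, ht₂⟩ ht.le)
    (fun y hy => hvh y ⟨norm_preimage_Icc_subset_annulus ht₁ ht₂ ?_, fun hyK => ?_⟩)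
    x₀ ⟨ht₁x.le, hxt₂'.le⟩
  · rcases hy with hy | hy <;> simp [hy, ht.le]
  · obtain ⟨hy₁, hy₂⟩ := hKt (Set.mem_insert_of_mem x₀ hyK)
    exact hy.elim hy₁.ne' (EReal.coe_lt_coe_iff.1 hy₂).ne

end Maximality

end STCone

end

theorem theorem8p2 (n : ℕ) (F : Set (STCone.SymMat n))
    (hF : STCone.IsSubequation F) (hcone : STCone.IsCone F) (hconv : Convex ℝ F)
    (hST : STCone.IsSTInvariant F)
    (a : ℝ) (b : EReal) (ha : 0 ≤ a)
    (U : STCone.Rn n → EReal)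
    (hU : STCone.IsSubharmonic F (STCone.annulus n a b) U)
    (hmono : MonotoneOn (STCone.sphericalAverage U) {t : ℝ | a < t ∧ (t : EReal) < b})
    (hharm : STCone.IsHarmonic F (STCone.annulus n a b)
      (fun x => STCone.sphericalAverage U ‖x‖)) :
    STCone.IsMaximal F (STCone.annulus n a b) U := by
  open STCone in
  refine ⟨hU, fun v hv K hKX hK hvU x₀ hx₀ => ?_⟩
  have hX := isOpen_annulus n a b
  have hne := hharm.nonempty hX hx₀
  have huniv := hharm.ne_univ hX hx₀
  have := nonempty_unitSphere_of_ne_zero (norm_pos_iff.1 (ha.trans_lt hx₀.1))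
  have hw := hv.max hU
  have hS := (hharm.isMaximal_radial hF hcone hconv hST ha hmono).2 _
    (hw.sphericalAverage_norm hF hcone hconv hST hne) (norm ⁻¹' (norm '' K))
    (fun y ⟨z, hz, hzy⟩ => mem_annulus_of_norm_eq (hKX hz) hzy.symm)
    (isCompact_norm_preimage (hK.image continuous_norm))
    fun y ⟨hy, hyK⟩ => (sphericalAverage_congr fun z hz => sup_eq_right.2
      (hvU z ⟨mem_annulus_of_norm_eq hy hz, fun hzK => hyK ⟨z, hzK, hz⟩⟩)).le
  have hwU : v x₀ ⊔ U x₀ ≤ U x₀ :=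
    hw.le_of_sphericalAverage_le hF hcone hconv hST hne huniv hU.usc (fun _ _ => le_sup_right)
      (fun x hx => (hharm.exists_eq_coe hx).elim fun r hr => hr ▸ EReal.coe_ne_bot r) hS hx₀
  exact le_sup_left.trans hwU
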